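/- Let $n\ge 2$ and identify $\mathbb{C}^n$ with $\mathbb{R}^{2n}$ via $(\xi_{k1}+i\xi_{k2})_{k}\mapsto(\xi_{11},\xi_{12},\dots,\xi_{n1},\xi_{n2})$. Let $\mathcal{K}_n$ be the set of convex bodies $K\subset\mathbb{R}^{2n}$ (compact, convex, with the origin in the interior) that are contained in the open unit ball and are $R_\theta$-invariant, i.e. the Minkowski functional $\|x\|_K=\min\{a\ge 0: x\in aK\}$ is invariant under the simultaneous rotation by $\theta$ of all pairs of coordinates $(x_{k1},x_{k2})$, for every $\theta\in[0,2\pi]$. For $\xi\in S^{2n-1}$ let $H_\xi=\{z\in\mathbb{C}^n:\sum_k z_k\overline{\xi_k}=0\}$, a real subspace of $\mathbb{R}^{2n}$ of dimension $2n-2$, and let $$\mathrm{HVol}_{2n}(K)=8^n\int_K\frac{dx}{(1-|x|^2)^{n+1}},\qquad \mathrm{HVol}_{2n-2}(K\cap H_\xi)=8^{n-1}\int_{K\cap H_\xi}\frac{dx}{(1-|x|^2)^{n}}$$ be the volumes in the ball model of complex hyperbolic space $\mathbb{H}_{\mathbb{C}}^n$. The following are equivalent. 1. (Affirmative answer to the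 Busemann-Petty problem in $\mathbb{H}_{\mathbb{C}}^n$.) For all $K,L\in\mathcal{K}_n$, if $\mathrm{HVol}_{2n-2}(K\cap H_\xi)\le \mathrm{HVol}_{2n-2}(L\cap H_\xi)$ for every $\xi\in S^{2n-1}$, then $\mathrm{HVol}_{2n}(K)\le\mathrm{HVol}_{2n}(L)$. 2. For every $K\in\mathcal{K}_n$ the function $$f_K(x)=\frac{\|x\|_K^{-2}}{1-\left(\frac{|x|}{\|x\|_K}\right)^2}$$ defines a (tempered) distribution $\varphi\mapsto\int_{\mathbb{R}^{2n}} f_K\varphi\,dx$ that is positive definite, i.e. $\langle f_K,\ \varphi*\overline{\varphi(-\,\cdot\,)}\rangle\ge 0$ for every Schwartz function $\varphi:\mathbb{R}^{2n}\to\mathbb{C}$. -/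

import Mathlib

open MeasureTheory
open scoped SchwartzMap ComplexConjugate

noncomputable section

namespace ComplexHyperbolicBP

/-- `ℝ²ⁿ` with its Euclidean structure. The coordinate `x (k, 0)` is the real part and `x (k, 1)`
the imaginary part of the `k`-th coordinate of the corresponding point of `ℂⁿ`. -/
abbrev RSpace (n : ℕ) : Type := EuclideanSpace ℝ (Fin n × Fin 2)

/-- The identification of `ℝ²ⁿ` with `ℂⁿ`. -/
def toComplex {n : ℕ} (x : RSpace n) (k : Fin n) : ℂ := ⟨x (k, 0), x (k, 1)⟩

/-- Counterclockwise rotation by `θ` applied to each pair of coordinates `(x (k, 0), x (k, 1))`. -/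
def rot {n : ℕ} (θ : ℝ) (x : RSpace n) : RSpace n :=
  WithLp.toLp 2 fun p =>
    if p.2 = 0 then Real.cos θ * x (p.1, 0) - Real.sin θ * x (p.1, 1)
    else Real.sin θ * x (p.1, 0) + Real.cos θ * x (p.1, 1)

/-- The vector `ξ_⊥ = (-ξ₁₂, ξ₁₁, …, -ξₙ₂, ξₙ₁)`, i.e. `i ξ` in complex notation. -/
def perp {n : ℕ} (ξ : RSpace n) : RSpace n :=
  WithLp.toLp 2 fun p => if p.2 = 0 then -ξ (p.1, 1) else ξ (p.1, 0)

/-- The complex hyperplane `H_ξ` as a real subspace of `ℝ²ⁿ`: the orthogonal complement of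
`ξ` and `ξ_⊥`. -/
def hyperplane {n : ℕ} (ξ : RSpace n) : Submodule ℝ (RSpace n) :=
  (Submodule.span ℝ {ξ, perp ξ})ᗮ

/-- In complex notation, `H_ξ` is given by the equation `∑ z_k * conj ξ_k = 0`. -/
theorem mem_hyperplane_iff {n : ℕ} (ξ x : RSpace n) :
    x ∈ hyperplane ξ ↔ ∑ k, toComplex x k * conj (toComplex ξ k) = 0 := by
  have h : x ∈ hyperplane ξ ↔ inner ℝ ξ x = 0 ∧ inner ℝ (perp ξ) x = 0 := by
    rw [hyperplane, Submodule.mem_orthogonal]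
    constructor
    · intro h
      exact ⟨h _ (Submodule.subset_span (by simp)), h _ (Submodule.subset_span (by simp))⟩
    · rintro ⟨h1, h2⟩ u hu
      obtain ⟨a, b, rfl⟩ := Submodule.mem_span_pair.1 hu
      simp [inner_add_left, inner_smul_left, h1, h2]
  rw [h, Complex.ext_iff]
  simp only [PiLp.inner_apply, Fintype.sum_prod_type, Fin.sum_univ_two, perp, toComplex,
    Complex.re_sum, Complex.im_sum]
  simp [mul_comm, sub_eq_add_neg]

/-- A coordinatewise rotation is multiplication by `exp (i θ)` in every coordinate. -/
theorem toComplex_rot {n : ℕ} (θ : ℝ) (x : RSpace n) (k : Fin n) :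
    toComplex (rot θ x) k = Complex.exp (θ * Complex.I) * toComplex x k := by
  apply Complex.ext <;>
    simp [toComplex, rot, Complex.exp_ofReal_mul_I_re, Complex.exp_ofReal_mul_I_im, add_comm]

/-- The Minkowski functional of `K` is invariant under all coordinatewise rotations. -/
def IsRotInvariant {n : ℕ} (K : Set (RSpace n)) : Prop :=
  ∀ θ ∈ Set.Icc (0 : ℝ) (2 * Real.pi), ∀ ξ : RSpace n, gauge K (rot θ ξ) = gauge K ξ

/-- The bodies of the problem: rotation-invariant convex bodies with the origin in the interior,
contained in the (open) unit ball, which is the ball model of complex hyperbolic space. -/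
structure IsAdmissible {n : ℕ} (K : ConvexBody (RSpace n)) : Prop where
  zero_mem_interior : (0 : RSpace n) ∈ interior (K : Set (RSpace n))
  rotInvariant : IsRotInvariant (K : Set (RSpace n))
  subset_ball : (K : Set (RSpace n)) ⊆ Metric.ball 0 1

section Volume

variable (V : Type*) [NormedAddCommGroup V] [InnerProductSpace ℝ V] [FiniteDimensional ℝ V]
  [MeasurableSpace V] [BorelSpace V]

/-- The volume measure `8 ^ m * (1 - |x|²) ^ (-(m + 1)) dx` of the ball model of complex hyperbolic
`m`-space, on the open unit ball of a Euclidean space `V` of real dimension `2 * m`; `dx` is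
Lebesgue measure of `V`. In polar coordinates it is
`8 ^ m * r ^ (2 * m - 1) * (1 - r²) ^ (-(m + 1)) dr dσ`. -/
def hypMeasure (m : ℕ) : Measure V :=
  ((volume : Measure V).restrict (Metric.ball 0 1)).withDensity
    fun x => ENNReal.ofReal (8 ^ m / (1 - ‖x‖ ^ 2) ^ (m + 1))

end Volume

/-- `HVol_{2n}(K)`. -/
def hvol {n : ℕ} (K : Set (RSpace n)) : ENNReal := hypMeasure (RSpace n) n K

/-- `HVol_{2n-2}(K ∩ H_ξ)`, computed in the `(2n-2)`-dimensional Euclidean space `H_ξ`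
(for `ξ ≠ 0`). -/
def hvolSection {n : ℕ} (K : Set (RSpace n)) (ξ : RSpace n) : ENNReal :=
  hypMeasure (hyperplane ξ) (n - 1) {x : hyperplane ξ | (x : RSpace n) ∈ K}

/-- The Busemann-Petty problem in complex hyperbolic `n`-space has an affirmative answer. -/
def BusemannPettyAffirmative (n : ℕ) : Prop :=
  ∀ K L : ConvexBody (RSpace n), IsAdmissible K → IsAdmissible L →
    (∀ ξ : RSpace n, ‖ξ‖ = 1 →
      hvolSection (K : Set (RSpace n)) ξ ≤ hvolSection (L : Set (RSpace n)) ξ) →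
    hvol (K : Set (RSpace n)) ≤ hvol (L : Set (RSpace n))

section Distribution

variable {V : Type*} [NormedAddCommGroup V] [InnerProductSpace ℝ V]

/-- The test function `x ↦ conj (φ (-x))`. -/
def conjReflect (φ : 𝓢(V, ℂ)) : 𝓢(V, ℂ) :=
  SchwartzMap.postcompCLM (𝕜 := ℝ) (Complex.conjCLE : ℂ →L[ℝ] ℂ)
    (SchwartzMap.compCLMOfContinuousLinearEquiv ℝ (ContinuousLinearEquiv.neg ℝ (M := V)) φ)

theorem conjReflect_apply (φ : 𝓢(V, ℂ)) (x : V) : conjReflect φ x = conj (φ (-x)) := by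
  simp [conjReflect]

variable [FiniteDimensional ℝ V] [MeasurableSpace V] [BorelSpace V]

/-- The test function `φ ∗ conj φ(-·)`. -/
def autoConv (φ : 𝓢(V, ℂ)) : 𝓢(V, ℂ) :=
  SchwartzMap.convolution (ContinuousLinearMap.mul ℂ ℂ) φ (conjReflect φ)

theorem autoConv_apply (φ : 𝓢(V, ℂ)) (x : V) :
    autoConv φ x = ∫ y, φ y * conj (φ (-(x - y))) := by
  simp [autoConv, SchwartzMap.convolution_apply, MeasureTheory.convolution, conjReflect_apply]

/-- A distribution `T` is positive definite if `⟨T, φ ∗ conj φ(-·)⟩` is a non-negative real number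
for every test function `φ`. -/
def IsPositiveDefinite (T : 𝓢'(V, ℂ)) : Prop :=
  ∀ φ : 𝓢(V, ℂ), 0 ≤ (T (autoConv φ)).re ∧ (T (autoConv φ)).im = 0

/-- The distribution `T` is the one given by integration against the function `f`. -/
def Represents (f : V → ℝ) (T : 𝓢'(V, ℂ)) : Prop :=
  ∀ φ : 𝓢(V, ℂ), Integrable (fun x => (f x : ℂ) * φ x) ∧ T φ = ∫ x, (f x : ℂ) * φ x

/-- The function `f` defines a tempered distribution, and this distribution is positive definite. -/
def IsPositiveDefiniteDistribution (f : V → ℝ) : Prop :=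
  ∃ T : 𝓢'(V, ℂ), Represents f T ∧ IsPositiveDefinite T

end Distribution

/-- The function `‖x‖_K⁻² / (1 - (|x| / ‖x‖_K)²)`. -/
def bpFunction {n : ℕ} (K : Set (RSpace n)) (x : RSpace n) : ℝ :=
  (gauge K x ^ 2)⁻¹ / (1 - (‖x‖ / gauge K x) ^ 2)

end ComplexHyperbolicBP

end

open MeasureTheory
open scoped SchwartzMap ComplexConjugate

noncomputable section

namespace ComplexHyperbolicBP

section Polar

variable {V : Type*} [NormedAddCommGroup V] [InnerProductSpace ℝ V]

/-- The surface measure of the unit sphere of a Euclidean space. -/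
abbrev sphereMeasure (V : Type*) [NormedAddCommGroup V] [InnerProductSpace ℝ V]
    [FiniteDimensional ℝ V] [MeasurableSpace V] [BorelSpace V] :
    Measure (Metric.sphere (0 : V) 1) :=
  (volume : Measure V).toSphere

theorem homeomorphUnitSphereProd_smul (x : ({0}ᶜ : Set V)) :
    ((homeomorphUnitSphereProd V x).2 : ℝ) • ((homeomorphUnitSphereProd V x).1 : V) = x := by
  have hx : ‖(x : V)‖ ≠ 0 := norm_ne_zero_iff.2 x.2
  simp [smul_smul, mul_inv_cancel₀ hx]

theorem lintegral_volumeIoiPow (k : ℕ) {g : ℝ → ENNReal} (hg : Measurable g) :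
    ∫⁻ r : Set.Ioi (0 : ℝ), g r ∂(Measure.volumeIoiPow k) =
      ∫⁻ r in Set.Ioi (0 : ℝ), ENNReal.ofReal (r ^ k) * g r := by
  rw [Measure.volumeIoiPow, lintegral_withDensity_eq_lintegral_mul _ (by fun_prop) (by fun_prop)]
  exact lintegral_subtype_comap measurableSet_Ioi
    (fun r : ℝ => ENNReal.ofReal (r ^ k) * g r)

theorem integral_volumeIoiPow {E : Type*} [NormedAddCommGroup E] [NormedSpace ℝ E] (k : ℕ)
    (g : ℝ → E) :
    ∫ r : Set.Ioi (0 : ℝ), g r ∂(Measure.volumeIoiPow k) =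
      ∫ r in Set.Ioi (0 : ℝ), r ^ k • g r := by
  simp only [Measure.volumeIoiPow, ENNReal.ofReal]
  rw [integral_withDensity_eq_integral_smul ((measurable_subtype_coe.pow_const _).real_toNNReal),
    integral_subtype_comap measurableSet_Ioi fun a ↦ Real.toNNReal (a ^ k) • g a,
    setIntegral_congr_fun measurableSet_Ioi fun x hx ↦ ?_]
  rw [NNReal.smul_def, Real.coe_toNNReal _ (pow_nonneg (Set.mem_Ioi.1 hx).le _)]

variable [FiniteDimensional ℝ V] [MeasurableSpace V] [BorelSpace V]

theorem lintegral_eq_lintegral_sphere [Nontrivial V] {f : V → ENNReal} (hf : Measurable f) :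
    ∫⁻ x, f x = ∫⁻ θ : Metric.sphere (0 : V) 1, (∫⁻ r in Set.Ioi (0 : ℝ),
      ENNReal.ofReal (r ^ (Module.finrank ℝ V - 1)) * f (r • (θ : V))) ∂sphereMeasure V := by
  have h1 : ∫⁻ x, f x = ∫⁻ x : ({0}ᶜ : Set V), f x ∂(volume.comap Subtype.val) := by
    rw [lintegral_subtype_comap (measurableSet_singleton _).compl, restrict_compl_singleton]
  have hm : Measurable fun p : Metric.sphere (0 : V) 1 × Set.Ioi (0 : ℝ) =>
      f ((p.2 : ℝ) • (p.1 : V)) := by fun_prop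
  have h2 := (Measure.measurePreserving_homeomorphUnitSphereProd
    (volume : Measure V)).lintegral_comp hm
  simp only [homeomorphUnitSphereProd_smul] at h2
  rw [h1, h2, lintegral_prod _ hm.aemeasurable]
  exact lintegral_congr fun θ =>
    lintegral_volumeIoiPow _ (g := fun r => f (r • (θ : V))) (by fun_prop)

theorem integral_eq_integral_sphere_prod [Nontrivial V] {E : Type*} [NormedAddCommGroup E]
    [NormedSpace ℝ E] (f : V → E) :
    ∫ x, f x = ∫ p : Metric.sphere (0 : V) 1 × Set.Ioi (0 : ℝ), f ((p.2 : ℝ) • (p.1 : V))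
      ∂((sphereMeasure V).prod (Measure.volumeIoiPow (Module.finrank ℝ V - 1))) := by
  have h1 : ∫ x, f x = ∫ x : ({0}ᶜ : Set V), f x ∂(volume.comap Subtype.val) := by
    rw [integral_subtype_comap (measurableSet_singleton _).compl, restrict_compl_singleton]
  have h2 := (Measure.measurePreserving_homeomorphUnitSphereProd
    (volume : Measure V)).integral_comp (Homeomorph.measurableEmbedding _)
    (fun p : Metric.sphere (0 : V) 1 × Set.Ioi (0 : ℝ) => f ((p.2 : ℝ) • (p.1 : V)))
  simp only [homeomorphUnitSphereProd_smul] at h2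
  rw [h1, h2]

theorem integrable_sphere_prod {E : Type*} [NormedAddCommGroup E] [NormedSpace ℝ E]
    {f : V → E} (hf : Integrable f) :
    Integrable (fun p : Metric.sphere (0 : V) 1 × Set.Ioi (0 : ℝ) => f ((p.2 : ℝ) • (p.1 : V)))
      ((sphereMeasure V).prod (Measure.volumeIoiPow (Module.finrank ℝ V - 1))) := by
  have h2 := (Measure.measurePreserving_homeomorphUnitSphereProd
    (volume : Measure V)).integrable_comp_emb (Homeomorph.measurableEmbedding _)
    (g := fun p : Metric.sphere (0 : V) 1 × Set.Ioi (0 : ℝ) => f ((p.2 : ℝ) • (p.1 : V)))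
  rw [← h2]
  have h3 : Integrable (f ∘ (Subtype.val : ({0}ᶜ : Set V) → V)) (volume.comap Subtype.val) := by
    rw [← integrableOn_iff_comap_subtypeVal (measurableSet_singleton _).compl]
    exact hf.integrableOn
  convert h3 using 1
  funext x
  simp only [Function.comp_apply, homeomorphUnitSphereProd_smul]

/-- Polar coordinates for an integrable function. -/
theorem integral_eq_integral_sphere [Nontrivial V] {E : Type*} [NormedAddCommGroup E]
    [NormedSpace ℝ E] {f : V → E} (hf : Integrable f) :
    ∫ x, f x = ∫ θ : Metric.sphere (0 : V) 1,
      (∫ r in Set.Ioi (0 : ℝ), r ^ (Module.finrank ℝ V - 1) • f (r • (θ : V))) ∂sphereMeasure V := by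
  rw [integral_eq_integral_sphere_prod, integral_prod _ (integrable_sphere_prod hf)]
  congr 1
  funext θ
  exact integral_volumeIoiPow _ (fun r => f (r • (θ : V)))

/-- Polar coordinates for a function that splits into a spherical and a radial factor. -/
theorem integral_eq_sphere_mul_radial [Nontrivial V] {f : V → ℝ}
    (a : Metric.sphere (0 : V) 1 → ℝ) (b : ℝ → ℝ)
    (h : ∀ θ : Metric.sphere (0 : V) 1, ∀ r : ℝ, 0 < r → f (r • (θ : V)) = a θ * b r) :
    ∫ x, f x = (∫ θ, a θ ∂sphereMeasure V) *
      ∫ r in Set.Ioi (0 : ℝ), r ^ (Module.finrank ℝ V - 1) * b r := by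
  rw [integral_eq_integral_sphere_prod]
  have : (fun p : Metric.sphere (0 : V) 1 × Set.Ioi (0 : ℝ) => f ((p.2 : ℝ) • (p.1 : V))) =
      fun p => a p.1 * b p.2 := by
    funext p
    exact h p.1 p.2 p.2.2
  rw [this, integral_prod_mul a (fun r : Set.Ioi (0 : ℝ) => b r), integral_volumeIoiPow]
  simp only [smul_eq_mul]

end Polar

section Isometry

variable {V : Type*} [NormedAddCommGroup V] [InnerProductSpace ℝ V]

/-- The action of a linear isometry on the unit sphere. -/
def sphereMap (T : V ≃ₗᵢ[ℝ] V) (θ : Metric.sphere (0 : V) 1) : Metric.sphere (0 : V) 1 :=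
  ⟨T θ, by simp⟩

theorem continuous_sphereMap (T : V ≃ₗᵢ[ℝ] V) : Continuous (sphereMap T) := by
  unfold sphereMap
  fun_prop

variable [FiniteDimensional ℝ V] [MeasurableSpace V] [BorelSpace V]

open scoped Pointwise in
theorem measurePreserving_sphereMap (T : V ≃ₗᵢ[ℝ] V) :
    MeasurePreserving (sphereMap T) (sphereMeasure V) (sphereMeasure V) := by
  refine ⟨(continuous_sphereMap T).measurable, ?_⟩
  ext s hs
  have hpre : MeasurableSet (sphereMap T ⁻¹' s) := (continuous_sphereMap T).measurable hs
  rw [Measure.map_apply (continuous_sphereMap T).measurable hs, Measure.toSphere_apply' _ hpre,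
    Measure.toSphere_apply' _ hs]
  congr 1
  have : Set.Ioo (0 : ℝ) 1 • (Subtype.val '' (sphereMap T ⁻¹' s)) =
      T ⁻¹' (Set.Ioo (0 : ℝ) 1 • (Subtype.val '' s)) := by
    ext x
    simp only [Set.mem_smul, Set.mem_image, Set.mem_preimage]
    constructor
    · rintro ⟨r, hr, _, ⟨θ, hθ, rfl⟩, rfl⟩
      exact ⟨r, hr, T θ, ⟨sphereMap T θ, hθ, rfl⟩, by simp⟩
    · rintro ⟨r, hr, _, ⟨θ, hθ, rfl⟩, h⟩
      refine ⟨r, hr, T.symm θ, ⟨sphereMap T.symm θ, ?_, rfl⟩, ?_⟩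
      · have : sphereMap T (sphereMap T.symm θ) = θ := by
          ext
          simp [sphereMap]
        rw [this]
        exact hθ
      · apply T.injective
        simpa using h
  rw [this]
  exact T.measurePreserving.measure_preimage_equiv (f := T.toMeasurableEquiv) _

theorem integral_sphereMap {E : Type*} [NormedAddCommGroup E] [NormedSpace ℝ E]
    (T : V ≃ₗᵢ[ℝ] V) (g : Metric.sphere (0 : V) 1 → E) :
    ∫ θ, g (sphereMap T θ) ∂sphereMeasure V = ∫ θ, g θ ∂sphereMeasure V := by
  have hinj : Function.Injective (sphereMap T) := by
    intro a b hab
    have := congrArg Subtype.val hab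
    exact Subtype.ext (T.injective this)
  exact (measurePreserving_sphereMap T).integral_comp
    ((continuous_sphereMap T).measurableEmbedding hinj) g

theorem integrable_sphere {E : Type*} [NormedAddCommGroup E]
    {g : Metric.sphere (0 : V) 1 → E} (hg : Continuous g) : Integrable g (sphereMeasure V) :=
  hg.integrable_of_hasCompactSupport (HasCompactSupport.of_compactSpace g)

/-- Second moments of the surface measure of the sphere. -/
theorem integral_sphere_inner_sq (e : V) :
    Module.finrank ℝ V * ∫ θ, inner ℝ (θ : V) e ^ 2 ∂sphereMeasure V =
      ‖e‖ ^ 2 * (sphereMeasure V).real Set.univ := by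
  have hc : ∀ a : V, Continuous fun θ : Metric.sphere (0 : V) 1 => inner ℝ (θ : V) a ^ 2 := by
    intro a
    fun_prop
  have key : ∀ a b : V, ‖a‖ = ‖b‖ → ∫ θ, inner ℝ (θ : V) a ^ 2 ∂sphereMeasure V =
      ∫ θ, inner ℝ (θ : V) b ^ 2 ∂sphereMeasure V := by
    intro a b hab
    let T : V ≃ₗᵢ[ℝ] V := (ℝ ∙ (a - b))ᗮ.reflection
    have hT : T a = b := Submodule.reflection_sub hab
    have := integral_sphereMap T fun θ : Metric.sphere (0 : V) 1 => inner ℝ (θ : V) b ^ 2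
    rw [← this, ← hT]
    congr 1
    funext θ
    show inner ℝ (θ : V) a ^ 2 = inner ℝ (T θ) (T a) ^ 2
    rw [T.inner_map_map]
  let b := stdOrthonormalBasis ℝ V
  have hb : ∀ i, ∫ θ, inner ℝ (θ : V) e ^ 2 ∂sphereMeasure V =
      ‖e‖ ^ 2 * ∫ θ, inner ℝ (θ : V) (b i) ^ 2 ∂sphereMeasure V := by
    intro i
    rw [key e (‖e‖ • b i) (by simp [norm_smul]), ← integral_const_mul]
    congr 1
    funext θ
    rw [inner_smul_right, mul_pow]
  have hsum : ∑ i, ∫ θ, inner ℝ (θ : V) (b i) ^ 2 ∂sphereMeasure V =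
      (sphereMeasure V).real Set.univ := by
    rw [← integral_finsetSum _ fun i _ => integrable_sphere (hc (b i))]
    have : ∀ θ : Metric.sphere (0 : V) 1, ∑ i, inner ℝ (θ : V) (b i) ^ 2 = 1 := by
      intro θ
      have := b.sum_sq_norm_inner_left (θ : V)
      simpa using this
    simp [this]
  rw [← hsum, Finset.mul_sum, ← Finset.sum_congr rfl fun i _ => hb i]
  simp

end Isometry

section HyperbolicVolume

theorem hasDerivAt_hyperbolic_antideriv {m : ℕ} (hm : 0 < m) {r : ℝ} (hr : r ^ 2 < 1) :
    HasDerivAt (fun r : ℝ => 8 ^ m / (2 * m) * (r ^ 2 / (1 - r ^ 2)) ^ m)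
      (r ^ (2 * m - 1) * (8 ^ m / (1 - r ^ 2) ^ (m + 1))) r := by
  have h0 : (1 : ℝ) - r ^ 2 ≠ 0 := by linarith
  have h1 : HasDerivAt (fun r : ℝ => r ^ 2) (2 * r) r := by simpa using hasDerivAt_pow 2 r
  have h2 := ((h1.div (h1.const_sub 1) h0).fun_pow m).const_mul ((8 : ℝ) ^ m / (2 * m))
  refine h2.congr_deriv ?_
  obtain ⟨k, rfl⟩ : ∃ k, m = k + 1 := ⟨m - 1, by omega⟩
  have hk : ((k + 1 : ℕ) : ℝ) ≠ 0 := by positivity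
  have e1 : 2 * (k + 1) - 1 = 2 * k + 1 := by omega
  rw [e1]
  simp only [Nat.add_sub_cancel, Pi.div_apply, div_pow]
  field_simp
  ring

theorem lintegral_hyperbolic_radial {m : ℕ} (hm : 0 < m) {a : ℝ} (ha : 1 < a) :
    ∫⁻ r in Set.Ioi (0 : ℝ), ENNReal.ofReal (r ^ (2 * m - 1)) *
      ({r : ℝ | r * a ≤ 1}.indicator
        (fun r => ENNReal.ofReal (8 ^ m / (1 - r ^ 2) ^ (m + 1))) r) =
      ENNReal.ofReal (8 ^ m / (2 * m) * ((a ^ 2 - 1)⁻¹) ^ m) := by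
  have ha0 : 0 < a := by linarith
  have hb : 0 ≤ a⁻¹ := by positivity
  have hlt : ∀ r ∈ Set.Icc 0 a⁻¹, r ^ 2 < 1 := by
    intro r hr
    have h1 : r < 1 := lt_of_le_of_lt hr.2 (inv_lt_one_of_one_lt₀ ha)
    nlinarith [hr.1]
  have hset : {r : ℝ | r * a ≤ 1} = Set.Iic a⁻¹ := by
    ext r
    simp only [Set.mem_ofPred_eq, Set.mem_Iic]
    rw [← one_div, le_div_iff₀ ha0]
  have hcont : ContinuousOn (fun r : ℝ => r ^ (2 * m - 1) * (8 ^ m / (1 - r ^ 2) ^ (m + 1)))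
      (Set.Icc 0 a⁻¹) := by
    apply ContinuousOn.mul (by fun_prop)
    apply ContinuousOn.div (by fun_prop) (by fun_prop)
    intro r hr
    have := hlt r hr
    exact pow_ne_zero _ (by linarith)
  calc _ = ∫⁻ r in Set.Ioi (0 : ℝ), (Set.Iic a⁻¹).indicator (fun r =>
        ENNReal.ofReal (r ^ (2 * m - 1) * (8 ^ m / (1 - r ^ 2) ^ (m + 1)))) r := by
        rw [hset]
        refine setLIntegral_congr_fun measurableSet_Ioi fun r hr => ?_
        by_cases h : r ∈ Set.Iic a⁻¹
        · simp only [Set.indicator_of_mem h]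
          rw [ENNReal.ofReal_mul (pow_nonneg (Set.mem_Ioi.1 hr).le _)]
        · simp only [Set.indicator_of_notMem h, mul_zero]
    _ = ∫⁻ r in Set.Ioc 0 a⁻¹,
        ENNReal.ofReal (r ^ (2 * m - 1) * (8 ^ m / (1 - r ^ 2) ^ (m + 1))) := by
        rw [lintegral_indicator measurableSet_Iic, Measure.restrict_restrict measurableSet_Iic,
          Set.inter_comm, Set.Ioi_inter_Iic]
    _ = ENNReal.ofReal (∫ r in (0 : ℝ)..a⁻¹,
        r ^ (2 * m - 1) * (8 ^ m / (1 - r ^ 2) ^ (m + 1))) := by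
        rw [intervalIntegral.integral_of_le hb, ofReal_integral_eq_lintegral_ofReal]
        · exact (hcont.integrableOn_Icc).mono_set Set.Ioc_subset_Icc_self
        · filter_upwards [ae_restrict_mem measurableSet_Ioc] with r hr
          have := hlt r ⟨hr.1.le, hr.2⟩
          have h1 : 0 < 1 - r ^ 2 := by linarith
          have h2 := hr.1
          exact mul_nonneg (pow_nonneg h2.le _) (by positivity)
    _ = _ := by
        rw [intervalIntegral.integral_eq_sub_of_hasDerivAt
          (f := fun r : ℝ => 8 ^ m / (2 * m) * (r ^ 2 / (1 - r ^ 2)) ^ m)]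
        · congr 1
          have e : (a⁻¹) ^ 2 / (1 - (a⁻¹) ^ 2) = (a ^ 2 - 1)⁻¹ := by
            have : a ^ 2 - 1 ≠ 0 := by nlinarith
            field_simp
          rw [e]
          simp [hm.ne']
        · intro r hr
          rw [Set.uIcc_of_le hb] at hr
          exact hasDerivAt_hyperbolic_antideriv hm (hlt r hr)
        · apply ContinuousOn.intervalIntegrable
          rwa [Set.uIcc_of_le hb]

variable {V : Type*} [NormedAddCommGroup V] [InnerProductSpace ℝ V] [FiniteDimensional ℝ V]
  [MeasurableSpace V] [BorelSpace V]

/-- The hyperbolic volume of a star body inside the unit ball, in terms of its gauge. -/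
theorem hypMeasure_eq_integral_sphere {m : ℕ} (hm : 0 < m) (hV : Module.finrank ℝ V = 2 * m)
    {g : V → ℝ} (hg : Continuous g) (hom : ∀ r : ℝ, 0 ≤ r → ∀ x, g (r • x) = r * g x)
    (h1 : ∀ x, ‖x‖ = 1 → 1 < g x) :
    hypMeasure V m {x | g x ≤ 1} = ENNReal.ofReal
      (8 ^ m / (2 * m) * ∫ θ, ((g (θ : V) ^ 2 - 1)⁻¹) ^ m ∂sphereMeasure V) := by
  have : Nontrivial V := Module.nontrivial_of_finrank_pos (R := ℝ) (by omega)
  have hK : MeasurableSet {x | g x ≤ 1} := (isClosed_le hg continuous_const).measurableSet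
  have hsub : {x | g x ≤ 1} ⊆ Metric.ball (0 : V) 1 := by
    intro x hx
    rw [mem_ball_zero_iff]
    by_contra hcon
    push Not at hcon
    have hx0 : 0 < ‖x‖ := by linarith
    have h2 : g x = ‖x‖ * g (‖x‖⁻¹ • x) := by
      rw [← hom _ hx0.le, smul_smul, mul_inv_cancel₀ hx0.ne', one_smul]
    have h3 := h1 (‖x‖⁻¹ • x) (by simp [norm_smul, hx0.ne'])
    have hx' : g x ≤ 1 := hx
    nlinarith
  have hd : Measurable fun x : V => ENNReal.ofReal (8 ^ m / (1 - ‖x‖ ^ 2) ^ (m + 1)) := by fun_prop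
  have hpos : ∀ θ : Metric.sphere (0 : V) 1, 0 < g (θ : V) ^ 2 - 1 := by
    intro θ
    have := h1 θ (by simp)
    nlinarith
  have hcont : Continuous fun θ : Metric.sphere (0 : V) 1 => ((g (θ : V) ^ 2 - 1)⁻¹) ^ m := by
    apply Continuous.pow
    apply Continuous.inv₀
    · fun_prop
    · exact fun θ => (hpos θ).ne'
  rw [hypMeasure, withDensity_apply _ hK, Measure.restrict_restrict hK,
    Set.inter_eq_left.2 hsub, ← lintegral_indicator hK,
    lintegral_eq_lintegral_sphere (hd.indicator hK), hV, ← integral_const_mul,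
    ofReal_integral_eq_lintegral_ofReal]
  · refine lintegral_congr fun θ => ?_
    rw [← lintegral_hyperbolic_radial hm (h1 θ (by simp))]
    refine setLIntegral_congr_fun measurableSet_Ioi fun r hr => ?_
    have hr' : 0 < r := hr
    simp only [Set.indicator, Set.mem_ofPred_eq, hom r hr'.le, norm_smul]
    simp [abs_of_pos hr']
  · exact (integrable_sphere hcont).const_mul _
  · refine Filter.Eventually.of_forall fun θ => ?_
    have := hpos θ
    simp only [Pi.zero_apply]
    positivity

end HyperbolicVolume

section Body

variable {n : ℕ} {K : ConvexBody (RSpace n)}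

namespace IsAdmissible

theorem mem_nhds (hK : IsAdmissible K) : (K : Set (RSpace n)) ∈ nhds (0 : RSpace n) :=
  mem_interior_iff_mem_nhds.1 hK.zero_mem_interior

theorem continuous_gauge (hK : IsAdmissible K) : Continuous (gauge (K : Set (RSpace n))) :=
  _root_.continuous_gauge K.convex hK.mem_nhds

theorem mem_iff (hK : IsAdmissible K) (x : RSpace n) :
    x ∈ (K : Set (RSpace n)) ↔ gauge (K : Set (RSpace n)) x ≤ 1 := by
  rw [gauge_le_one_iff_mem_closure K.convex hK.mem_nhds, K.isClosed.closure_eq]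

theorem norm_lt_gauge (hK : IsAdmissible K) {x : RSpace n} (hx : x ≠ 0) :
    ‖x‖ < gauge (K : Set (RSpace n)) x := by
  have ha : Absorbent ℝ (K : Set (RSpace n)) := absorbent_nhds_zero hK.mem_nhds
  have hpos : 0 < gauge (K : Set (RSpace n)) x :=
    (gauge_pos ha ((NormedSpace.isVonNBounded_iff ℝ).2 K.isBounded)).2 hx
  have hmem : (gauge (K : Set (RSpace n)) x)⁻¹ • x ∈ (K : Set (RSpace n)) := by
    rw [hK.mem_iff, gauge_smul_of_nonneg (inv_nonneg.2 hpos.le), smul_eq_mul,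
      inv_mul_cancel₀ hpos.ne']
  have := hK.subset_ball hmem
  rw [mem_ball_zero_iff, norm_smul, norm_inv, Real.norm_of_nonneg hpos.le,
    inv_mul_lt_iff₀ hpos, mul_one] at this
  exact this

theorem one_lt_gauge (hK : IsAdmissible K) {x : RSpace n} (hx : ‖x‖ = 1) :
    1 < gauge (K : Set (RSpace n)) x := by
  rw [← hx]
  exact hK.norm_lt_gauge (by rintro rfl; simp at hx)

end IsAdmissible

theorem bpFunction_eq (hK : IsAdmissible K) {x : RSpace n} (hx : x ≠ 0) :
    bpFunction (K : Set (RSpace n)) x = (gauge (K : Set (RSpace n)) x ^ 2 - ‖x‖ ^ 2)⁻¹ := by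
  have h := hK.norm_lt_gauge hx
  have h0 : 0 < ‖x‖ := norm_pos_iff.2 hx
  have h1 : 0 < gauge (K : Set (RSpace n)) x := h0.trans h
  have h2 : 0 < gauge (K : Set (RSpace n)) x ^ 2 - ‖x‖ ^ 2 := by nlinarith
  unfold bpFunction
  rw [div_pow, div_eq_iff]
  · field_simp
  · field_simp
    exact (div_pos h2 (by positivity)).ne'

theorem bpFunction_smul (K : Set (RSpace n)) {r : ℝ} (hr : 0 < r) (x : RSpace n) :
    bpFunction K (r • x) = (r ^ 2)⁻¹ * bpFunction K x := by
  unfold bpFunction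
  rw [gauge_smul_of_nonneg hr.le, norm_smul, Real.norm_of_nonneg hr.le, smul_eq_mul,
    mul_div_mul_left _ _ hr.ne', mul_pow, mul_inv, mul_div_assoc]

/-- The restriction of `bpFunction K` to the unit sphere. -/
theorem bpFunction_sphere (hK : IsAdmissible K) (θ : Metric.sphere (0 : RSpace n) 1) :
    bpFunction (K : Set (RSpace n)) θ = (gauge (K : Set (RSpace n)) (θ : RSpace n) ^ 2 - 1)⁻¹ := by
  rw [bpFunction_eq hK (ne_zero_of_mem_unit_sphere θ)]
  simp

theorem bpFunction_pos (hK : IsAdmissible K) {x : RSpace n} (hx : x ≠ 0) :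
    0 < bpFunction (K : Set (RSpace n)) x := by
  rw [bpFunction_eq hK hx, inv_pos]
  have := hK.norm_lt_gauge hx
  nlinarith [norm_nonneg x]

theorem continuousOn_bpFunction (hK : IsAdmissible K) :
    ContinuousOn (bpFunction (K : Set (RSpace n))) {0}ᶜ := by
  refine ContinuousOn.congr
    (f := fun x => (gauge (K : Set (RSpace n)) x ^ 2 - ‖x‖ ^ 2)⁻¹) ?_ fun x hx => bpFunction_eq hK hx
  apply ContinuousOn.inv₀
  · have := hK.continuous_gauge
    fun_prop
  · intro x hx
    have := bpFunction_pos hK hx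
    rw [bpFunction_eq hK hx, inv_pos] at this
    exact this.ne'

theorem continuous_bpFunction_sphere (hK : IsAdmissible K) :
    Continuous fun θ : Metric.sphere (0 : RSpace n) 1 => bpFunction (K : Set (RSpace n)) θ :=
  (continuousOn_bpFunction hK).comp_continuous continuous_subtype_val
    ne_zero_of_mem_unit_sphere

theorem finrank_RSpace (n : ℕ) : Module.finrank ℝ (RSpace n) = 2 * n := by
  simp [mul_comm]

theorem hvol_eq (hn : 0 < n) (hK : IsAdmissible K) :
    hvol (K : Set (RSpace n)) = ENNReal.ofReal (8 ^ n / (2 * n) *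
      ∫ θ : Metric.sphere (0 : RSpace n) 1, bpFunction (K : Set (RSpace n)) θ ^ n
        ∂sphereMeasure (RSpace n)) := by
  have h := hypMeasure_eq_integral_sphere hn (finrank_RSpace n) hK.continuous_gauge
    (fun r hr x => gauge_smul_of_nonneg hr x) fun x hx => hK.one_lt_gauge hx
  have hset : {x | gauge (K : Set (RSpace n)) x ≤ 1} = (K : Set (RSpace n)) := by
    ext x
    exact (hK.mem_iff x).symm
  rw [hset] at h
  rw [hvol, h]
  simp only [bpFunction_sphere hK]

theorem norm_sq_eq (x : RSpace n) : ‖x‖ ^ 2 = ∑ k, (x (k, 0) ^ 2 + x (k, 1) ^ 2) := by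
  rw [EuclideanSpace.norm_sq_eq, Fintype.sum_prod_type]
  simp [Fin.sum_univ_two]

theorem norm_perp (ξ : RSpace n) : ‖perp ξ‖ = ‖ξ‖ := by
  rw [← sq_eq_sq₀ (norm_nonneg _) (norm_nonneg _), norm_sq_eq, norm_sq_eq]
  simp [perp, add_comm]

theorem inner_perp (ξ : RSpace n) : inner ℝ ξ (perp ξ) = 0 := by
  simp only [PiLp.inner_apply, Fintype.sum_prod_type, Fin.sum_univ_two, perp]
  simp [mul_comm]

theorem finrank_hyperplane {ξ : RSpace n} (hξ : ‖ξ‖ = 1) :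
    Module.finrank ℝ (hyperplane ξ) = 2 * (n - 1) := by
  have hli : LinearIndependent ℝ ![ξ, perp ξ] := by
    have : Orthonormal ℝ ![ξ, perp ξ] := by
      rw [orthonormal_iff_ite]
      have h1 : inner ℝ (perp ξ) ξ = 0 := by rw [real_inner_comm, inner_perp]
      intro i j
      fin_cases i <;> fin_cases j <;>
        simp [norm_perp, hξ, inner_perp, h1]
    exact this.linearIndependent
  have h2 : Module.finrank ℝ (Submodule.span ℝ {ξ, perp ξ}) = 2 := by
    have := finrank_span_eq_card hli
    rw [Matrix.range_cons_cons_empty] at this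
    simpa using this
  have := Submodule.finrank_add_finrank_orthogonal (Submodule.span ℝ {ξ, perp ξ})
  rw [h2, finrank_RSpace] at this
  unfold hyperplane
  omega

theorem hvolSection_eq (hn : 2 ≤ n) (hK : IsAdmissible K) {ξ : RSpace n} (hξ : ‖ξ‖ = 1) :
    hvolSection (K : Set (RSpace n)) ξ = ENNReal.ofReal (8 ^ (n - 1) / (2 * (n - 1 : ℕ)) *
      ∫ θ : Metric.sphere (0 : hyperplane ξ) 1,
        bpFunction (K : Set (RSpace n)) ((θ : hyperplane ξ) : RSpace n) ^ (n - 1)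
        ∂sphereMeasure (hyperplane ξ)) := by
  have h := hypMeasure_eq_integral_sphere (V := hyperplane ξ) (m := n - 1) (by omega)
    (finrank_hyperplane hξ) (g := fun x => gauge (K : Set (RSpace n)) (x : RSpace n))
    (hK.continuous_gauge.comp continuous_subtype_val)
    (fun r hr x => gauge_smul_of_nonneg hr (x : RSpace n)) fun x hx => hK.one_lt_gauge hx
  have hset : {x : hyperplane ξ | gauge (K : Set (RSpace n)) x ≤ 1} =
      {x : hyperplane ξ | (x : RSpace n) ∈ (K : Set (RSpace n))} := by
    ext x
    exact (hK.mem_iff x).symm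
  rw [hset] at h
  rw [hvolSection, h]
  congr 3
  funext θ
  have hθ : ‖((θ : hyperplane ξ) : RSpace n)‖ = 1 := mem_sphere_zero_iff_norm.1 θ.2
  rw [bpFunction_sphere hK ⟨_, mem_sphere_zero_iff_norm.2 hθ⟩]

end Body

section QuadraticSupport

/-- A `C²` function on `[0, 1]` is supported from below by parabolas of bounded shape. -/
theorem exists_quadratic_support {p : ℝ → ℝ} (hp : ∀ s ∈ Set.Icc (0 : ℝ) 1, ContDiffAt ℝ 2 p s) :
    ∃ D C : ℝ, 0 ≤ D ∧ 0 ≤ C ∧ ∀ a ∈ Set.Icc (0 : ℝ) 1, ∃ l : ℝ, |l| ≤ D ∧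
      ∀ s ∈ Set.Icc (0 : ℝ) 1, p a + l * (s - a) - C * (s - a) ^ 2 ≤ p s := by
  have h1 : ∀ s ∈ Set.Icc (0 : ℝ) 1, ContDiffAt ℝ 1 (deriv p) s := fun s hs =>
    ContDiffAt.derivWithin (hp s hs) (by norm_num)
  have h2 : ∀ s ∈ Set.Icc (0 : ℝ) 1, ContDiffAt ℝ 0 (deriv (deriv p)) s := fun s hs =>
    ContDiffAt.derivWithin (h1 s hs) (by norm_num)
  obtain ⟨D, hD⟩ := isCompact_Icc.exists_bound_of_continuousOn
    (fun s hs => (h1 s hs).continuousAt.continuousWithinAt : ContinuousOn (deriv p) (Set.Icc 0 1))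
  obtain ⟨C, hC⟩ := isCompact_Icc.exists_bound_of_continuousOn
    (fun s hs => (h2 s hs).continuousAt.continuousWithinAt :
      ContinuousOn (deriv (deriv p)) (Set.Icc 0 1))
  have h0 : (0 : ℝ) ∈ Set.Icc (0 : ℝ) 1 := by simp
  refine ⟨D, C, (norm_nonneg _).trans (hD 0 h0), (norm_nonneg _).trans (hC 0 h0),
    fun a ha => ⟨deriv p a, hD a ha, fun s hs => ?_⟩⟩
  have hseg : Set.uIcc a s ⊆ Set.Icc (0 : ℝ) 1 := Set.uIcc_subset_Icc ha hs
  have hlip : ∀ t ∈ Set.uIcc a s, ‖deriv p t - deriv p a‖ ≤ C * ‖s - a‖ := by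
    intro t ht
    refine ((convex_Icc (0 : ℝ) 1).norm_image_sub_le_of_norm_deriv_le
      (fun x hx => (h1 x hx).differentiableAt (by norm_num)) hC ha (hseg ht)).trans ?_
    refine mul_le_mul_of_nonneg_left ?_ ((norm_nonneg _).trans (hC 0 h0))
    exact Set.abs_sub_left_of_mem_uIcc ht
  have hder : ∀ t ∈ Set.uIcc a s, HasDerivWithinAt (fun t => p t - deriv p a * t)
      (deriv p t - deriv p a) (Set.uIcc a s) t := by
    intro t ht
    have e1 := ((hp t (hseg ht)).differentiableAt (by norm_num)).hasDerivAt
    have e2 := (hasDerivAt_id t).const_mul (deriv p a)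
    simpa using (e1.fun_sub e2).hasDerivWithinAt
  have := (convex_uIcc a s).norm_image_sub_le_of_norm_hasDerivWithin_le hder hlip
    Set.left_mem_uIcc Set.right_mem_uIcc
  rw [mul_assoc, ← pow_two, Real.norm_eq_abs, Real.norm_eq_abs, sq_abs] at this
  have := neg_le_of_abs_le this
  nlinarith

end QuadraticSupport

section AxialForm

variable {V W : Type*} [NormedAddCommGroup V] [InnerProductSpace ℝ V]
  [NormedAddCommGroup W] [InnerProductSpace ℝ W]

theorem norm_sq_convex_combination (x y : V) {α β : ℝ} (h : α + β = 1) :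
    ‖α • x + β • y‖ ^ 2 = α * ‖x‖ ^ 2 + β * ‖y‖ ^ 2 - α * β * ‖x - y‖ ^ 2 := by
  rw [norm_add_sq_real, norm_sub_sq_real, inner_smul_left, inner_smul_right, norm_smul, norm_smul,
    mul_pow, mul_pow, Real.norm_eq_abs, Real.norm_eq_abs, sq_abs, sq_abs]
  obtain rfl : β = 1 - α := by linarith
  simp
  ring

/-- The squared ratio of the norm of a component of `x` to the norm of `x`. -/
def axialRatio (P : V →ₗ[ℝ] W) (x : V) : ℝ := ‖P x‖ ^ 2 / ‖x‖ ^ 2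

/-- The function `|x|² (1 + ε p (s))`, where `s` is the axial ratio of `x`. -/
def axialForm (P : V →ₗ[ℝ] W) (ε : ℝ) (p : ℝ → ℝ) (x : V) : ℝ :=
  ‖x‖ ^ 2 * (1 + ε * p (axialRatio P x))

variable {P : V →ₗ[ℝ] W}

theorem axialRatio_mem (hP : ∀ x, ‖P x‖ ≤ ‖x‖) (x : V) : axialRatio P x ∈ Set.Icc (0 : ℝ) 1 := by
  refine ⟨by unfold axialRatio; positivity, ?_⟩
  exact div_le_one_of_le₀ (pow_le_pow_left₀ (norm_nonneg _) (hP x) 2) (by positivity)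

theorem norm_sq_mul_axialRatio (P : V →ₗ[ℝ] W) (x : V) : ‖x‖ ^ 2 * axialRatio P x = ‖P x‖ ^ 2 := by
  unfold axialRatio
  by_cases hx : x = 0
  · simp [hx]
  · have := norm_ne_zero_iff.2 hx
    field_simp

theorem norm_mul_abs_axialRatio_sub_le (hP : ∀ x, ‖P x‖ ≤ ‖x‖) (x : V) {z : V} (hz : z ≠ 0) :
    ‖x‖ * |axialRatio P x - axialRatio P z| ≤ 4 * ‖x - z‖ := by
  set v := ‖P z‖ / ‖z‖ with hv
  set u := ‖P x‖ / ‖x‖ with hu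
  have hz0 : 0 < ‖z‖ := norm_pos_iff.2 hz
  have hv0 : 0 ≤ v := by positivity
  have hu0 : 0 ≤ u := by positivity
  have hv1 : v ≤ 1 := div_le_one_of_le₀ (hP z) (norm_nonneg z)
  have hu1 : u ≤ 1 := div_le_one_of_le₀ (hP x) (norm_nonneg x)
  have hPx : ‖x‖ * u = ‖P x‖ := by
    by_cases hx : x = 0
    · simp [hx]
    · have : ‖x‖ ≠ 0 := norm_ne_zero_iff.2 hx
      rw [hu]
      field_simp
  have hPz : ‖z‖ * v = ‖P z‖ := by
    rw [hv]
    field_simp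
  have e1 : axialRatio P x - axialRatio P z = (u - v) * (u + v) := by
    simp only [axialRatio, hu, hv, ← div_pow]
    ring
  have e2 : |‖P x‖ - ‖P z‖| ≤ ‖x - z‖ := by
    refine (abs_norm_sub_norm_le _ _).trans ?_
    rw [← map_sub]
    exact hP _
  have e3 : |‖z‖ - ‖x‖| ≤ ‖x - z‖ := by
    rw [norm_sub_rev]
    exact abs_norm_sub_norm_le _ _
  have e4 : ‖x‖ * |u - v| ≤ 2 * ‖x - z‖ := by
    calc ‖x‖ * |u - v| = |(‖P x‖ - ‖P z‖) + (‖z‖ - ‖x‖) * v| := by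
          rw [← abs_of_nonneg (norm_nonneg x), ← abs_mul, abs_of_nonneg (norm_nonneg x),
            ← hPx, ← hPz]
          ring_nf
      _ ≤ |‖P x‖ - ‖P z‖| + |‖z‖ - ‖x‖| * v := by
          refine (abs_add_le _ _).trans ?_
          rw [abs_mul, abs_of_nonneg hv0]
      _ ≤ ‖x - z‖ + ‖x - z‖ * 1 := by
          gcongr
      _ = 2 * ‖x - z‖ := by ring
  rw [e1, abs_mul, abs_of_nonneg (by positivity : 0 ≤ u + v), ← mul_assoc]
  have := norm_nonneg (x - z)
  calc ‖x‖ * |u - v| * (u + v) ≤ (2 * ‖x - z‖) * 2 := by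
        gcongr
        linarith
    _ = _ := by ring

theorem convexOn_axialForm (hP : ∀ x, ‖P x‖ ≤ ‖x‖) {p : ℝ → ℝ} {D C ε : ℝ} (hpos : ∀ s ∈ Set.Icc (0 : ℝ) 1, 0 ≤ p s)
    (hC : 0 ≤ C)
    (hsup : ∀ a ∈ Set.Icc (0 : ℝ) 1, ∃ l : ℝ, |l| ≤ D ∧
      ∀ s ∈ Set.Icc (0 : ℝ) 1, p a + l * (s - a) - C * (s - a) ^ 2 ≤ p s)
    (hε : 0 ≤ ε) (hε' : ε * (2 * D + 16 * C) ≤ 1) :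
    ConvexOn ℝ Set.univ (axialForm P ε p) := by
  refine ⟨convex_univ, ?_⟩
  intro x _ y _ α β hα hβ hαβ
  have hnn : ∀ x, 0 ≤ axialForm P ε p x := fun x => by
    have := hpos _ (axialRatio_mem hP x)
    unfold axialForm
    positivity
  set z := α • x + β • y with hz
  simp only [smul_eq_mul]
  by_cases hz0 : z = 0
  · have h1 := mul_nonneg hα (hnn x)
    have h2 := mul_nonneg hβ (hnn y)
    rw [hz0]
    simp only [axialForm, norm_zero] at *
    linarith
  set a := axialRatio P z with ha
  have ha' : a ∈ Set.Icc (0 : ℝ) 1 := axialRatio_mem hP z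
  obtain ⟨l, hl, hs⟩ := hsup a ha'
  have lower : ∀ w, (1 + ε * (p a - l * a)) * ‖w‖ ^ 2 + ε * l * ‖P w‖ ^ 2
      - 16 * C * ε * ‖w - z‖ ^ 2 ≤ axialForm P ε p w := by
    intro w
    have h1 := hs _ (axialRatio_mem hP w)
    have h2 := norm_mul_abs_axialRatio_sub_le hP w hz0
    have h3 : ‖w‖ ^ 2 * (axialRatio P w - a) ^ 2 ≤ 16 * ‖w - z‖ ^ 2 := by
      have := pow_le_pow_left₀ (by positivity) h2 2
      rw [mul_pow, sq_abs] at this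
      linarith
    have h4 := mul_le_mul_of_nonneg_left h1 (by positivity : 0 ≤ ε * ‖w‖ ^ 2)
    have h5 := mul_le_mul_of_nonneg_left h3 (by positivity : 0 ≤ ε * C)
    have h6 := norm_sq_mul_axialRatio P w
    unfold axialForm
    rw [← h6]
    linarith
  have hzQ : axialForm P ε p z = (1 + ε * (p a - l * a)) * ‖z‖ ^ 2 + ε * l * ‖P z‖ ^ 2 := by
    rw [← norm_sq_mul_axialRatio P z]
    unfold axialForm
    ring
  have hx := mul_le_mul_of_nonneg_left (lower x) hα
  have hy := mul_le_mul_of_nonneg_left (lower y) hβ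
  have dx : ‖x - z‖ ^ 2 = β ^ 2 * ‖x - y‖ ^ 2 := by
    have : x - z = β • (x - y) := by
      obtain rfl : α = 1 - β := by linarith
      rw [hz]
      module
    rw [this, norm_smul, mul_pow, Real.norm_eq_abs, sq_abs]
  have dy : ‖y - z‖ ^ 2 = α ^ 2 * ‖x - y‖ ^ 2 := by
    have : y - z = -(α • (x - y)) := by
      obtain rfl : β = 1 - α := by linarith
      rw [hz]
      module
    rw [this, norm_neg, norm_smul, mul_pow, Real.norm_eq_abs, sq_abs]
  have nz := norm_sq_convex_combination x y hαβ
  have nPz := norm_sq_convex_combination (P x) (P y) hαβ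
  rw [← map_smul, ← map_smul, ← map_add, ← map_sub, ← hz] at nPz
  rw [← hz] at nz
  set d := ‖x - y‖ ^ 2 with hd
  have hd0 : 0 ≤ d := by positivity
  have hPd : ‖P (x - y)‖ ^ 2 ≤ d := pow_le_pow_left₀ (norm_nonneg _) (hP _) 2
  have hPd0 : 0 ≤ ‖P (x - y)‖ ^ 2 := by positivity
  have hl' := abs_le.1 hl
  have hD : 0 ≤ D := (abs_nonneg l).trans hl
  have b1 : -(ε * D * d) ≤ ε * l * ‖P (x - y)‖ ^ 2 := by
    have : |ε * l * ‖P (x - y)‖ ^ 2| ≤ ε * D * d := by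
      rw [abs_mul, abs_mul, abs_of_nonneg hε, abs_of_nonneg hPd0]
      gcongr
    linarith [neg_le_of_abs_le this]
  have b2 : 1 - ε * D ≤ 1 + ε * (p a - l * a) := by
    have h1 := hpos a ha'
    have h2 : l * a ≤ D := by nlinarith [ha'.1, ha'.2]
    nlinarith
  have b3 := mul_le_mul_of_nonneg_right b2 hd0
  have b4 := mul_le_mul_of_nonneg_right hε' hd0
  have key : 0 ≤ (1 + ε * (p a - l * a)) * d + ε * l * ‖P (x - y)‖ ^ 2 - 16 * C * ε * d := by
    linarith
  have key2 := mul_nonneg (mul_nonneg hα hβ) key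
  rw [dx] at hx
  rw [dy] at hy
  rw [hzQ, nz, nPz]
  have e : α * (16 * C * ε * (β ^ 2 * d)) + β * (16 * C * ε * (α ^ 2 * d)) =
      α * β * (16 * C * ε * d) * (α + β) := by ring
  rw [hαβ, mul_one] at e
  linarith

theorem axialRatio_smul {r : ℝ} (hr : r ≠ 0) (x : V) : axialRatio P (r • x) = axialRatio P x := by
  unfold axialRatio
  rw [map_smul, norm_smul, norm_smul, mul_pow, mul_pow, mul_div_mul_left]
  exact pow_ne_zero _ (norm_ne_zero_iff.2 hr)

theorem axialForm_smul (ε : ℝ) (p : ℝ → ℝ) (r : ℝ) (x : V) :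
    axialForm P ε p (r • x) = r ^ 2 * axialForm P ε p x := by
  by_cases hr : r = 0
  · simp [hr, axialForm]
  · unfold axialForm
    rw [axialRatio_smul hr, norm_smul, mul_pow, Real.norm_eq_abs, sq_abs]
    ring

/-- The gauge of a sublevel set of a positive function of degree two. -/
theorem gauge_sublevel_of_homogeneous {Q : V → ℝ} (hom : ∀ (r : ℝ) x, Q (r • x) = r ^ 2 * Q x)
    (hpos : ∀ x, x ≠ 0 → 0 < Q x) (x : V) : gauge {x | Q x ≤ 1} x = √(Q x) := by
  by_cases hx : x = 0
  · have : Q 0 = 0 := by simpa using hom 0 0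
    simp [hx, this]
  have hQ := hpos x hx
  rw [gauge_def']
  have : {r ∈ Set.Ioi (0 : ℝ) | r⁻¹ • x ∈ {x | Q x ≤ 1}} = Set.Ici (√(Q x)) := by
    ext r
    simp only [Set.mem_Ioi, Set.mem_ofPred_eq, Set.mem_Ici, hom]
    constructor
    · rintro ⟨hr, h⟩
      rw [inv_pow, inv_mul_le_iff₀ (by positivity), mul_one] at h
      exact Real.sqrt_le_iff.2 ⟨hr.le, h⟩
    · intro h
      have hr : 0 < r := (Real.sqrt_pos.2 hQ).trans_le h
      refine ⟨hr, ?_⟩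
      rw [inv_pow, inv_mul_le_iff₀ (by positivity), mul_one]
      exact (Real.sqrt_le_iff.1 h).2
  rw [this, csInf_Ici]

end AxialForm

section AxialBody

variable {n : ℕ}

/-- The `k`-th complex coordinate as a real-linear map. -/
def coordMap (k : Fin n) : RSpace n →ₗ[ℝ] ℂ where
  toFun x := toComplex x k
  map_add' x y := by
    apply Complex.ext <;> simp [toComplex]
  map_smul' r x := by
    apply Complex.ext <;> simp [toComplex]

theorem norm_sq_coordMap (k : Fin n) (x : RSpace n) :
    ‖coordMap k x‖ ^ 2 = x (k, 0) ^ 2 + x (k, 1) ^ 2 := by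
  rw [Complex.sq_norm, Complex.normSq_apply]
  simp [coordMap, toComplex, pow_two]

theorem norm_sq_eq_sum_coordMap (x : RSpace n) : ‖x‖ ^ 2 = ∑ k, ‖coordMap k x‖ ^ 2 := by
  rw [norm_sq_eq]
  simp only [norm_sq_coordMap]

theorem norm_coordMap_le (k : Fin n) (x : RSpace n) : ‖coordMap k x‖ ≤ ‖x‖ := by
  rw [← sq_le_sq₀ (norm_nonneg _) (norm_nonneg _), norm_sq_eq_sum_coordMap]
  exact Finset.single_le_sum (f := fun k => ‖coordMap k x‖ ^ 2) (fun _ _ => by positivity)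
    (Finset.mem_univ k)

theorem norm_coordMap_rot (k : Fin n) (t : ℝ) (x : RSpace n) :
    ‖coordMap k (rot t x)‖ = ‖coordMap k x‖ := by
  show ‖toComplex (rot t x) k‖ = ‖toComplex x k‖
  rw [toComplex_rot, norm_mul, Complex.norm_exp_ofReal_mul_I, one_mul]

theorem norm_rot (t : ℝ) (x : RSpace n) : ‖rot t x‖ = ‖x‖ := by
  rw [← sq_eq_sq₀ (norm_nonneg _) (norm_nonneg _), norm_sq_eq_sum_coordMap,
    norm_sq_eq_sum_coordMap]
  simp only [norm_coordMap_rot]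

/-- Admissible bodies whose radial function is a prescribed function of one complex coordinate,
up to a scaling which brings them close to the boundary of the unit ball. -/
theorem exists_isAdmissible_axial (k : Fin n) {p : ℝ → ℝ}
    (hp : ∀ s ∈ Set.Icc (0 : ℝ) 1, ContDiffAt ℝ 2 p s)
    (hpos : ∀ s ∈ Set.Icc (0 : ℝ) 1, 0 < p s) :
    ∃ ε₀ > 0, ∀ ε, 0 < ε → ε ≤ ε₀ → ∃ K : ConvexBody (RSpace n), IsAdmissible K ∧
      ∀ x, ‖x‖ = 1 → bpFunction (K : Set (RSpace n)) x = (ε * p (‖coordMap k x‖ ^ 2))⁻¹ := by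
  obtain ⟨D, C, hD, hC, hsup⟩ := exists_quadratic_support hp
  refine ⟨1 / (2 * D + 16 * C + 1), by positivity, fun ε hε hε₀ => ?_⟩
  have hP := norm_coordMap_le k
  have hε' : ε * (2 * D + 16 * C) ≤ 1 := by
    rw [le_div_iff₀ (by positivity)] at hε₀
    nlinarith
  set Q := axialForm (coordMap k) ε p with hQ
  have hconv : ConvexOn ℝ Set.univ Q :=
    convexOn_axialForm hP (fun s hs => (hpos s hs).le) hC hsup hε.le hε'
  have hcont : Continuous Q := by
    rw [← continuousOn_univ]
    exact hconv.continuousOn isOpen_univ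
  have hgt : ∀ x, x ≠ 0 → ‖x‖ ^ 2 < Q x := by
    intro x hx
    have h1 := hpos _ (axialRatio_mem hP x)
    have h2 : 0 < ‖x‖ := norm_pos_iff.2 hx
    have : Q x = ‖x‖ ^ 2 + ‖x‖ ^ 2 * (ε * p (axialRatio (coordMap k) x)) := by
      rw [hQ, axialForm]
      ring
    rw [this]
    have : 0 < ‖x‖ ^ 2 * (ε * p (axialRatio (coordMap k) x)) := by positivity
    linarith
  have hQ0 : Q 0 = 0 := by simp [hQ, axialForm]
  have hball : {x | Q x ≤ 1} ⊆ Metric.ball (0 : RSpace n) 1 := by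
    intro x hx
    have hx' : Q x ≤ 1 := hx
    rw [mem_ball_zero_iff]
    by_cases h0 : x = 0
    · simp [h0]
    · have := hgt x h0
      nlinarith [norm_nonneg x]
  let K : ConvexBody (RSpace n) :=
    { carrier := {x | Q x ≤ 1}
      convex' := by simpa using hconv.convex_le 1
      isCompact' := Metric.isCompact_of_isClosed_isBounded (isClosed_le hcont continuous_const)
        (Metric.isBounded_ball.subset hball)
      nonempty' := ⟨0, by simp [hQ0]⟩ }
  have hKc : (K : Set (RSpace n)) = {x | Q x ≤ 1} := rfl
  have hgauge : ∀ x, gauge (K : Set (RSpace n)) x = √(Q x) := by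
    rw [hKc]
    exact gauge_sublevel_of_homogeneous (axialForm_smul ε p)
      fun x hx => (by positivity : 0 ≤ ‖x‖ ^ 2).trans_lt (hgt x hx)
  have hK : IsAdmissible K := by
    refine ⟨?_, ?_, hball⟩
    · rw [mem_interior_iff_mem_nhds, hKc]
      filter_upwards [hcont.continuousAt.eventually_lt continuousAt_const
        (show Q 0 < 1 by rw [hQ0]; norm_num)] with x hx
      exact hx.le
    · intro t _ x
      rw [hgauge, hgauge]
      simp only [hQ, axialForm, axialRatio, norm_rot, norm_coordMap_rot]
  refine ⟨K, hK, fun x hx => ?_⟩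
  have hx0 : x ≠ 0 := by rintro rfl; simp at hx
  have h1 := hgt x hx0
  rw [bpFunction_eq hK hx0, hgauge, Real.sq_sqrt (by nlinarith [norm_nonneg x])]
  simp [hQ, axialForm, axialRatio, hx]

end AxialBody

section Negative

variable {n : ℕ}

theorem continuous_coordMap (k : Fin n) : Continuous (coordMap k) :=
  (coordMap k).continuous_of_finiteDimensional

theorem norm_sq_coordMap_mem (k : Fin n) {x : RSpace n} (hx : ‖x‖ = 1) :
    ‖coordMap k x‖ ^ 2 ∈ Set.Icc (0 : ℝ) 1 :=
  ⟨by positivity, by simpa [hx] using pow_le_pow_left₀ (norm_nonneg _) (norm_coordMap_le k x) 2⟩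

theorem sub_inv_le_mul_exp {c : ℝ} (hc : 0 < c) (y : ℝ) :
    c * max y 0 ^ 2 - 1 / c ≤ y * Real.exp (c * y) := by
  rcases le_total 0 y with hy | hy
  · rw [max_eq_left hy]
    have h1 := Real.add_one_le_exp (c * y)
    have h2 : c * y * y ≤ Real.exp (c * y) * y := mul_le_mul_of_nonneg_right (by linarith) hy
    have h3 : 0 < 1 / c := by positivity
    nlinarith
  · rw [max_eq_right hy]
    have h1 : c * -y ≤ Real.exp (c * -y) := by linarith [Real.add_one_le_exp (c * -y)]
    have h2 : Real.exp (c * y) * Real.exp (c * -y) = 1 := by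
      rw [← Real.exp_add]
      simp
    have h3 := mul_le_mul_of_nonneg_left h1 (Real.exp_pos (c * y)).le
    rw [h2] at h3
    have h4 : -y * Real.exp (c * y) ≤ 1 / c := by
      rw [le_div_iff₀ hc]
      linarith
    linarith

/-- An exponential weight concentrates an integral over the sphere near the axis. -/
theorem exists_integral_exp_mul_neg (k : Fin n) {m : ℝ} (hm : 1 < m) :
    ∃ c : ℝ, 0 < c ∧ ∫ θ : Metric.sphere (0 : RSpace n) 1,
      Real.exp (c * ‖coordMap k θ‖ ^ 2) * (1 - m * ‖coordMap k θ‖ ^ 2)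
        ∂sphereMeasure (RSpace n) < 0 := by
  have hcm := continuous_coordMap k
  set σ := sphereMeasure (RSpace n) with hσ
  let y : Metric.sphere (0 : RSpace n) 1 → ℝ := fun θ => ‖coordMap k θ‖ ^ 2 - 1 / m
  have hy : Continuous y := by fun_prop
  have hy2 : Continuous fun θ => max (y θ) 0 ^ 2 := by fun_prop
  set A := ∫ θ, max (y θ) 0 ^ 2 ∂σ with hA
  have hApos : 0 < A := by
    let e : Metric.sphere (0 : RSpace n) 1 := ⟨EuclideanSpace.single (k, 0) 1, by simp⟩
    refine hy2.integral_pos_of_hasCompactSupport_nonneg_nonzero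
      (HasCompactSupport.of_compactSpace _) (fun θ => sq_nonneg _) (x := e) ?_
    have : y e = 1 - 1 / m := by
      simp [y, e, norm_sq_coordMap]
    have h1 : 1 / m < 1 := by rw [div_lt_one (by linarith)]; exact hm
    rw [this, max_eq_left (by linarith)]
    exact pow_ne_zero _ (by linarith)
  have hS : 0 ≤ σ.real Set.univ := measureReal_nonneg
  set c := σ.real Set.univ / A + 1 with hc
  have hc1 : 1 ≤ c := by
    have : 0 ≤ σ.real Set.univ / A := by positivity
    linarith
  have hc0 : 0 < c := by linarith
  refine ⟨c, hc0, ?_⟩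
  have hye : Continuous fun θ => y θ * Real.exp (c * y θ) := by fun_prop
  have hpos : 0 < ∫ θ, y θ * Real.exp (c * y θ) ∂σ := by
    have hle : ∫ θ, (c * max (y θ) 0 ^ 2 - 1 / c) ∂σ ≤ ∫ θ, y θ * Real.exp (c * y θ) ∂σ :=
      integral_mono (integrable_sphere (by fun_prop)) (integrable_sphere hye)
        fun θ => sub_inv_le_mul_exp hc0 (y θ)
    rw [integral_sub (integrable_sphere (by fun_prop)) (integrable_sphere (by fun_prop)),
      integral_const_mul, ← hA, integral_const, smul_eq_mul] at hle
    refine lt_of_lt_of_le ?_ hle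
    have h1 : c * A = σ.real Set.univ + A := by
      rw [hc]
      field_simp
    have h2 : σ.real Set.univ * (1 / c) ≤ σ.real Set.univ := by
      refine mul_le_of_le_one_right hS ?_
      rw [div_le_one hc0]
      exact hc1
    linarith
  have hm0 : m ≠ 0 := by linarith
  have heq : ∀ θ : Metric.sphere (0 : RSpace n) 1,
      Real.exp (c * ‖coordMap k θ‖ ^ 2) * (1 - m * ‖coordMap k θ‖ ^ 2) =
        -(m * Real.exp (c / m)) * (y θ * Real.exp (c * y θ)) := by
    intro θ
    have : Real.exp (c * ‖coordMap k θ‖ ^ 2) = Real.exp (c / m) * Real.exp (c * y θ) := by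
      rw [← Real.exp_add]
      congr 1
      simp only [y]
      ring
    rw [this]
    simp only [y]
    field_simp
    ring
  simp only [heq]
  rw [integral_const_mul]
  have := Real.exp_pos (c / m)
  have : 0 < m * Real.exp (c / m) := by positivity
  nlinarith

theorem inner_single (p : Fin n × Fin 2) (x : RSpace n) :
    inner ℝ x (EuclideanSpace.single p (1 : ℝ)) = x p := by
  rw [EuclideanSpace.inner_single_right]
  simp

/-- On every section the mean of `|x_k|²` is at most that of a section through the axis. -/
theorem integral_section_nonneg (hn : 2 ≤ n) (k : Fin n) {ξ : RSpace n} (hξ : ‖ξ‖ = 1) :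
    0 ≤ ∫ θ : Metric.sphere (0 : hyperplane ξ) 1,
      (1 - (n - 1 : ℕ) * ‖coordMap k ((θ : hyperplane ξ) : RSpace n)‖ ^ 2)
        ∂sphereMeasure (hyperplane ξ) := by
  set H := hyperplane ξ with hH
  have hm : 0 < ((n - 1 : ℕ) : ℝ) := by
    have : 0 < n - 1 := by omega
    positivity
  have hmom : ∀ p : Fin n × Fin 2, (2 * (n - 1 : ℕ) : ℝ) *
      ∫ θ : Metric.sphere (0 : H) 1, (((θ : H) : RSpace n) p) ^ 2 ∂sphereMeasure H ≤
        (sphereMeasure H).real Set.univ := by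
    intro p
    set e : RSpace n := EuclideanSpace.single p (1 : ℝ)
    have h1 := integral_sphere_inner_sq (V := H) (H.orthogonalProjectionOnto e)
    have h2 : ∀ θ : Metric.sphere (0 : H) 1,
        inner ℝ (θ : H) (H.orthogonalProjectionOnto e) = ((θ : H) : RSpace n) p := by
      intro θ
      rw [← inner_single p ((θ : H) : RSpace n), Submodule.coe_inner,
        ← Submodule.starProjection_apply, ← Submodule.inner_starProjection_left_eq_right,
        Submodule.starProjection_eq_self_iff.2 (θ : H).2]
    have hfr : Module.finrank ℝ H = 2 * (n - 1) := finrank_hyperplane hξ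
    simp only [h2, hfr] at h1
    push_cast at h1
    rw [h1]
    refine mul_le_of_le_one_left measureReal_nonneg ?_
    refine pow_le_one₀ (norm_nonneg _) ?_
    refine (Submodule.norm_orthogonalProjectionOnto_apply_le _ _).trans ?_
    simp [e]
  have hc : ∀ p : Fin n × Fin 2, Integrable
      (fun θ : Metric.sphere (0 : H) 1 => (((θ : H) : RSpace n) p) ^ 2) (sphereMeasure H) :=
    fun p => integrable_sphere (by fun_prop)
  simp only [norm_sq_coordMap, mul_add]
  rw [integral_sub (integrable_const _) (((hc _).const_mul _).fun_add ((hc _).const_mul _)),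
    integral_add ((hc _).const_mul _) ((hc _).const_mul _), integral_const_mul, integral_const_mul]
  have h0 := hmom (k, 0)
  have h1 := hmom (k, 1)
  simp only [integral_const, smul_eq_mul, mul_one]
  linarith

theorem mul_pow_mul_le (m : ℕ) {a b : ℝ} (ha : 0 < a) (hb : 0 < b) :
    (m + 1) * (a ^ m * b) ≤ m * a ^ (m + 1) + b ^ (m + 1) := by
  have h := one_add_mul_le_pow (a := b / a - 1) (by
    have : 0 < b / a := by positivity
    linarith) (m + 1)
  rw [add_sub_cancel, div_pow, le_div_iff₀ (by positivity)] at h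
  have e : (1 + ((m + 1 : ℕ) : ℝ) * (b / a - 1)) * a ^ (m + 1) =
      (m + 1) * (a ^ m * b) - m * a ^ (m + 1) := by
    push_cast
    field_simp
    ring
  linarith

/-- The Busemann-Petty problem has a negative answer in dimension at least three. -/
theorem not_busemannPettyAffirmative (hn : 3 ≤ n) : ¬ BusemannPettyAffirmative n := by
  intro hBP
  obtain ⟨m, rfl⟩ : ∃ m, n = m + 1 := ⟨n - 1, by omega⟩
  have hm : 2 ≤ m := by omega
  have hmR : (2 : ℝ) ≤ m := by exact_mod_cast hm
  have hm0 : (m : ℝ) ≠ 0 := by linarith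
  let k : Fin (m + 1) := 0
  obtain ⟨c, hc, hneg⟩ := exists_integral_exp_mul_neg k (m := m) (by linarith)
  let u : ℝ → ℝ := fun s => Real.exp (m * c * s) - (1 - m * s) / 2
  have hu : ∀ s ∈ Set.Icc (0 : ℝ) 1, 0 < u s := by
    intro s hs
    have h1 : 1 ≤ Real.exp (m * c * s) := Real.one_le_exp (by have := hs.1; positivity)
    have h2 : 0 ≤ m * s := by have := hs.1; positivity
    simp only [u]
    linarith
  let p₁ : ℝ → ℝ := fun s => Real.exp (-(c * s))
  let p₂ : ℝ → ℝ := fun s => u s ^ (-(1 / m : ℝ))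
  obtain ⟨ε₁, hε₁, h₁⟩ := exists_isAdmissible_axial k (p := p₁)
    (fun s _ => by
      have : ContDiff ℝ 2 p₁ := by fun_prop
      exact this.contDiffAt) (fun s _ => Real.exp_pos _)
  obtain ⟨ε₂, hε₂, h₂⟩ := exists_isAdmissible_axial k (p := p₂)
    (fun s hs => by
      have : ContDiff ℝ 2 u := by fun_prop
      exact this.contDiffAt.rpow_const_of_ne (hu s hs).ne') (fun s hs => Real.rpow_pos_of_pos (hu s hs) _)
  set ε := min ε₁ ε₂ with hε
  have hε0 : 0 < ε := lt_min hε₁ hε₂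
  obtain ⟨L, hL, hFL⟩ := h₁ ε hε0 (min_le_left _ _)
  obtain ⟨K, hK, hFK⟩ := h₂ ε hε0 (min_le_right _ _)
  have eL : ∀ x : RSpace (m + 1), ‖x‖ = 1 → bpFunction (L : Set (RSpace (m + 1))) x =
      ε⁻¹ * Real.exp (c * ‖coordMap k x‖ ^ 2) := by
    intro x hx
    rw [hFL x hx, mul_inv]
    simp only [p₁]
    rw [Real.exp_neg, inv_inv]
  have ne : ∀ x : RSpace (m + 1), ‖x‖ = 1 → x ≠ 0 := by
    rintro x hx rfl
    simp at hx
  have ediff : ∀ x : RSpace (m + 1), ‖x‖ = 1 → bpFunction (K : Set (RSpace (m + 1))) x ^ m =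
      bpFunction (L : Set (RSpace (m + 1))) x ^ m -
        ε⁻¹ ^ m / 2 * (1 - m * ‖coordMap k x‖ ^ 2) := by
    intro x hx
    have hux := hu _ (norm_sq_coordMap_mem k hx)
    rw [eL x hx, hFK x hx, mul_inv, mul_pow, mul_pow]
    simp only [p₂]
    rw [← Real.rpow_neg hux.le, neg_neg, ← Real.rpow_natCast (_ ^ (1 / m : ℝ)), ← Real.rpow_mul hux.le,
      one_div, inv_mul_cancel₀ hm0, Real.rpow_one, ← Real.exp_nat_mul]
    simp only [u]
    rw [mul_assoc]
    ring
  have hcm := continuous_coordMap k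
  have hsec : ∀ ξ : RSpace (m + 1), ‖ξ‖ = 1 →
      hvolSection (K : Set (RSpace (m + 1))) ξ ≤ hvolSection (L : Set (RSpace (m + 1))) ξ := by
    intro ξ hξ
    rw [hvolSection_eq (by omega) hK hξ, hvolSection_eq (by omega) hL hξ]
    refine ENNReal.ofReal_le_ofReal (mul_le_mul_of_nonneg_left ?_ (by positivity))
    have hG := integral_section_nonneg (by omega) k hξ
    simp only [Nat.add_sub_cancel] at hG ⊢
    have hcL : Continuous fun θ : Metric.sphere (0 : hyperplane ξ) 1 =>
        bpFunction (L : Set (RSpace (m + 1))) ((θ : hyperplane ξ) : RSpace (m + 1)) ^ m := by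
      apply Continuous.pow
      exact (continuousOn_bpFunction hL).comp_continuous (by fun_prop)
        fun θ => ne _ (mem_sphere_zero_iff_norm.1 θ.2)
    rw [integral_congr_ae (Filter.Eventually.of_forall fun θ : Metric.sphere (0 : hyperplane ξ) 1 =>
      ediff _ (mem_sphere_zero_iff_norm.1 θ.2)), integral_sub (integrable_sphere hcL)
      (integrable_sphere (by fun_prop)), integral_const_mul]
    have : 0 ≤ ε⁻¹ ^ m / 2 := by positivity
    have := mul_nonneg this hG
    linarith
  have hvol := hBP K L hK hL hsec
  rw [hvol_eq (by omega) hK, hvol_eq (by omega) hL] at hvol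
  have hcK := continuous_bpFunction_sphere hK
  have hcL := continuous_bpFunction_sphere hL
  have hI : 0 ≤ ∫ θ : Metric.sphere (0 : RSpace (m + 1)) 1,
      bpFunction (L : Set (RSpace (m + 1))) θ ^ (m + 1) ∂sphereMeasure (RSpace (m + 1)) :=
    integral_nonneg fun θ =>
      pow_nonneg (bpFunction_pos hL (ne_zero_of_mem_unit_sphere θ)).le _
  rw [ENNReal.ofReal_le_ofReal_iff (by positivity)] at hvol
  replace hvol := le_of_mul_le_mul_left hvol (by positivity)
  have hyoung : ∫ θ : Metric.sphere (0 : RSpace (m + 1)) 1, (m + 1 : ℝ) *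
      (bpFunction (K : Set (RSpace (m + 1))) θ ^ m * bpFunction (L : Set (RSpace (m + 1))) θ)
        ∂sphereMeasure (RSpace (m + 1)) ≤
      ∫ θ : Metric.sphere (0 : RSpace (m + 1)) 1,
        (m * bpFunction (K : Set (RSpace (m + 1))) θ ^ (m + 1) +
          bpFunction (L : Set (RSpace (m + 1))) θ ^ (m + 1)) ∂sphereMeasure (RSpace (m + 1)) :=
    integral_mono (integrable_sphere (by fun_prop)) (integrable_sphere (by fun_prop)) fun θ =>
      mul_pow_mul_le m (bpFunction_pos hK (ne_zero_of_mem_unit_sphere θ))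
        (bpFunction_pos hL (ne_zero_of_mem_unit_sphere θ))
  rw [integral_add (integrable_sphere (by fun_prop)) (integrable_sphere (by fun_prop)),
    integral_const_mul, integral_const_mul] at hyoung
  have hprod : ∫ θ : Metric.sphere (0 : RSpace (m + 1)) 1,
      bpFunction (K : Set (RSpace (m + 1))) θ ^ m * bpFunction (L : Set (RSpace (m + 1))) θ
        ∂sphereMeasure (RSpace (m + 1)) =
      ∫ θ : Metric.sphere (0 : RSpace (m + 1)) 1,
        bpFunction (L : Set (RSpace (m + 1))) θ ^ (m + 1) ∂sphereMeasure (RSpace (m + 1)) -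
      ε⁻¹ ^ (m + 1) / 2 * ∫ θ : Metric.sphere (0 : RSpace (m + 1)) 1,
        Real.exp (c * ‖coordMap k θ‖ ^ 2) * (1 - m * ‖coordMap k θ‖ ^ 2)
        ∂sphereMeasure (RSpace (m + 1)) := by
    rw [← integral_const_mul, ← integral_sub (integrable_sphere (by fun_prop))
      (integrable_sphere (by fun_prop))]
    congr 1
    funext θ
    have hθ : ‖(θ : RSpace (m + 1))‖ = 1 := by simp
    rw [ediff _ hθ, eL _ hθ]
    ring
  rw [hprod] at hyoung
  have h3 : ε⁻¹ ^ (m + 1) / 2 * ∫ θ : Metric.sphere (0 : RSpace (m + 1)) 1,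
        Real.exp (c * ‖coordMap k θ‖ ^ 2) * (1 - m * ‖coordMap k θ‖ ^ 2)
        ∂sphereMeasure (RSpace (m + 1)) < 0 := mul_neg_of_pos_of_neg (by positivity) hneg
  have h4 := mul_neg_of_pos_of_neg (by positivity : (0 : ℝ) < m + 1) h3
  have h5 := mul_le_mul_of_nonneg_left hvol (by positivity : (0 : ℝ) ≤ m)
  linarith

end Negative

section Gaussian

theorem norm_iteratedFDeriv_exp (i : ℕ) (t : ℝ) :
    ‖iteratedFDeriv ℝ i Real.exp t‖ = Real.exp t := by
  rw [norm_iteratedFDeriv_eq_norm_iteratedDeriv, iteratedDeriv_eq_iterate, Real.iter_deriv_exp,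
    Real.norm_of_nonneg (Real.exp_pos t).le]

theorem exists_pow_mul_exp_neg_sq_le {b : ℝ} (hb : 0 < b) (N : ℕ) :
    ∃ C, 0 ≤ C ∧ ∀ t : ℝ, 0 ≤ t → (1 + t) ^ N * Real.exp (-(b * t ^ 2)) ≤ C := by
  refine ⟨N.factorial * Real.exp (1 + 1 / (4 * b)), by positivity, fun t ht => ?_⟩
  have h1 : (1 + t) ^ N ≤ N.factorial * Real.exp (1 + t) := by
    have := Real.pow_div_factorial_le_exp (1 + t) (by linarith) N
    rwa [div_le_iff₀ (by positivity), mul_comm] at this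
  calc (1 + t) ^ N * Real.exp (-(b * t ^ 2))
      ≤ N.factorial * Real.exp (1 + t) * Real.exp (-(b * t ^ 2)) := by gcongr
    _ = N.factorial * Real.exp (1 + t + -(b * t ^ 2)) := by rw [mul_assoc, ← Real.exp_add]
    _ ≤ _ := by
        refine mul_le_mul_of_nonneg_left (Real.exp_le_exp.2 ?_) (by positivity)
        have : 0 ≤ b * (t - 1 / (2 * b)) ^ 2 := by positivity
        have e : b * (t - 1 / (2 * b)) ^ 2 = b * t ^ 2 - t + 1 / (4 * b) := by
          field_simp
          ring
        linarith

variable {V : Type*} [NormedAddCommGroup V] [InnerProductSpace ℝ V]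

/-- The Gaussian `exp (-b |x|²)` as a Schwartz function. -/
def gaussian (V : Type*) [NormedAddCommGroup V] [InnerProductSpace ℝ V] (b : ℝ) (hb : 0 < b) :
    𝓢(V, ℝ) where
  toFun x := Real.exp (-(b * ‖x‖ ^ 2))
  smooth' := by
    have : ContDiff ℝ (⊤ : ℕ∞) fun x : V => ‖x‖ ^ 2 := contDiff_norm_sq ℝ
    fun_prop
  decay' k i := by
    have hf : Function.HasTemperateGrowth fun x : V => -(b * ‖x‖ ^ 2) := by
      have h1 := Function.hasTemperateGrowth_norm_sq (H := V)
      have h2 := ((Function.HasTemperateGrowth.const (E := V) b).mul h1).neg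
      exact h2
    obtain ⟨l, D, hD, hbound⟩ := hf.norm_iteratedFDeriv_le_uniform i
    obtain ⟨C, hC, hexp⟩ := exists_pow_mul_exp_neg_sq_le hb (k + l * i)
    refine ⟨i.factorial * (D + 1) ^ i * C, fun x => ?_⟩
    have hx := norm_nonneg x
    have hone : 1 ≤ (D + 1) * (1 + ‖x‖) ^ l := by
      have : 1 ≤ (1 + ‖x‖) ^ l := one_le_pow₀ (by linarith)
      nlinarith
    have h := norm_iteratedFDeriv_comp_le (g := Real.exp) (f := fun x : V => -(b * ‖x‖ ^ 2))
      (N := (⊤ : ℕ∞)) (n := i) (Real.contDiff_exp) hf.1 (by exact_mod_cast le_top) x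
      (C := Real.exp (-(b * ‖x‖ ^ 2))) (D := (D + 1) * (1 + ‖x‖) ^ l)
      (fun j _ => (norm_iteratedFDeriv_exp j _).le) (fun j hj hji => by
        refine (hbound j hji x).trans ?_
        refine le_trans ?_ (le_self_pow₀ hone (by omega))
        gcongr
        linarith)
    calc ‖x‖ ^ k * ‖iteratedFDeriv ℝ i (fun x : V => Real.exp (-(b * ‖x‖ ^ 2))) x‖
        ≤ (1 + ‖x‖) ^ k * (i.factorial * Real.exp (-(b * ‖x‖ ^ 2)) *
            ((D + 1) * (1 + ‖x‖) ^ l) ^ i) := by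
          gcongr
          · linarith
          · exact h
      _ = i.factorial * (D + 1) ^ i *
            ((1 + ‖x‖) ^ (k + l * i) * Real.exp (-(b * ‖x‖ ^ 2))) := by
          rw [mul_pow, pow_add, pow_mul]
          ring
      _ ≤ _ := by
          gcongr
          exact hexp ‖x‖ hx

theorem gaussian_apply (b : ℝ) (hb : 0 < b) (x : V) :
    gaussian V b hb x = Real.exp (-(b * ‖x‖ ^ 2)) := rfl

/-- The test function `⟨x, e⟩ exp (-|x|²)`. -/
def hermiteTest (e : V) : 𝓢(V, ℂ) :=
  SchwartzMap.postcompCLM (𝕜 := ℝ) Complex.ofRealCLM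
    (SchwartzMap.smulLeftCLM ℝ (fun x : V => inner ℝ x e) (gaussian V 1 one_pos))

theorem hermiteTest_apply (e x : V) :
    hermiteTest e x = ((inner ℝ x e * Real.exp (-‖x‖ ^ 2) : ℝ) : ℂ) := by
  rw [hermiteTest, SchwartzMap.postcompCLM_apply, SchwartzMap.smulLeftCLM_apply_apply (by fun_prop)]
  simp [gaussian_apply]

variable [FiniteDimensional ℝ V] [MeasurableSpace V] [BorelSpace V]

theorem integrable_gaussian {b : ℝ} (hb : 0 < b) :
    Integrable fun x : V => Real.exp (-(b * ‖x‖ ^ 2)) :=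
  (gaussian V b hb).integrable

theorem integrable_inner_sq_mul_gaussian {b : ℝ} (hb : 0 < b) (e : V) :
    Integrable fun x : V => inner ℝ x e ^ 2 * Real.exp (-(b * ‖x‖ ^ 2)) := by
  have := (SchwartzMap.smulLeftCLM ℝ (fun x : V => inner ℝ x e ^ 2)
    (gaussian V b hb)).integrable (μ := volume)
  refine this.congr (Filter.Eventually.of_forall fun x => ?_)
  dsimp only
  rw [SchwartzMap.smulLeftCLM_apply_apply (by fun_prop)]
  simp [gaussian_apply]

/-- The one-dimensional moments of a Gaussian. -/
def radialMoment (b : ℝ) (q : ℕ) : ℝ :=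
  ∫ r in Set.Ioi (0 : ℝ), r ^ q * Real.exp (-(b * r ^ 2))

theorem integrableOn_radialMoment {b : ℝ} (hb : 0 < b) (q : ℕ) :
    IntegrableOn (fun r : ℝ => r ^ q * Real.exp (-(b * r ^ 2))) (Set.Ioi 0) := by
  have := (integrable_rpow_mul_exp_neg_mul_sq hb (s := q)
    (by have : (0 : ℝ) ≤ q := by positivity
        linarith)).integrableOn (s := Set.Ioi 0)
  refine this.congr_fun (fun r _ => ?_) measurableSet_Ioi
  simp

theorem radialMoment_eq {b : ℝ} (hb : 0 < b) (q : ℕ) : radialMoment b q =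
    b ^ (-(q + 1 : ℝ) / 2) * (1 / 2) * Real.Gamma ((q + 1) / 2) := by
  rw [← integral_rpow_mul_exp_neg_mul_rpow two_pos
    (by have : (0 : ℝ) ≤ q := by positivity
        linarith) hb]
  simp [radialMoment]

theorem radialMoment_pos {b : ℝ} (hb : 0 < b) (q : ℕ) : 0 < radialMoment b q := by
  rw [radialMoment_eq hb]
  have : 0 < Real.Gamma ((q + 1) / 2) := Real.Gamma_pos_of_pos (by positivity)
  positivity

theorem radialMoment_add_two {b : ℝ} (hb : 0 < b) (q : ℕ) :
    radialMoment b (q + 2) = (q + 1) / (2 * b) * radialMoment b q := by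
  rw [radialMoment_eq hb, radialMoment_eq hb]
  have e1 : (((q + 2 : ℕ) : ℝ) + 1) / 2 = ((q : ℝ) + 1) / 2 + 1 := by
    push_cast
    ring
  have e2 : -(((q + 2 : ℕ) : ℝ) + 1) / 2 = -((q : ℝ) + 1) / 2 - 1 := by
    push_cast
    ring
  rw [e1, e2, Real.Gamma_add_one (by positivity), Real.rpow_sub_one hb.ne']
  field_simp

theorem integral_inner_sq_mul_gaussian [Nontrivial V] {b : ℝ} (hb : 0 < b) (e : V) :
    ∫ x : V, inner ℝ x e ^ 2 * Real.exp (-(b * ‖x‖ ^ 2)) =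
      ‖e‖ ^ 2 / (2 * b) * ∫ x : V, Real.exp (-(b * ‖x‖ ^ 2)) := by
  have hd : 0 < Module.finrank ℝ V := Module.finrank_pos
  rw [integral_eq_sphere_mul_radial (fun θ : Metric.sphere (0 : V) 1 => inner ℝ (θ : V) e ^ 2)
      (fun r => r ^ 2 * Real.exp (-(b * r ^ 2)))
      (by
        intro θ r hr
        rw [inner_smul_left, norm_smul]
        simp
        ring),
    integral_eq_sphere_mul_radial (fun _ : Metric.sphere (0 : V) 1 => (1 : ℝ))
      (fun r => Real.exp (-(b * r ^ 2)))
      (by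
        intro θ r hr
        rw [norm_smul]
        simp)]
  have h1 := integral_sphere_inner_sq e
  have h2 := radialMoment_add_two hb (Module.finrank ℝ V - 1)
  have e1 : ∀ r : ℝ, r ^ (Module.finrank ℝ V - 1) * (r ^ 2 * Real.exp (-(b * r ^ 2))) =
      r ^ (Module.finrank ℝ V - 1 + 2) * Real.exp (-(b * r ^ 2)) := by
    intro r
    rw [pow_add]
    ring
  simp only [e1]
  change _ * radialMoment b _ = _ * (_ * radialMoment b _)
  rw [h2]
  have e2 : ((Module.finrank ℝ V - 1 : ℕ) : ℝ) + 1 = Module.finrank ℝ V := by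
    rw [Nat.cast_sub hd]
    simp
  rw [e2, integral_const, smul_eq_mul, mul_one]
  calc _ = (Module.finrank ℝ V * ∫ θ : Metric.sphere (0 : V) 1, inner ℝ (θ : V) e ^ 2
        ∂sphereMeasure V) / (2 * b) * radialMoment b (Module.finrank ℝ V - 1) := by ring
    _ = _ := by
        rw [h1]
        ring

theorem autoConv_hermiteTest [Nontrivial V] {e : V} (he : ‖e‖ = 1) (x : V) :
    autoConv (hermiteTest e) x = (((∫ u : V, Real.exp (-(2 * ‖u‖ ^ 2))) / 4 *
      ((1 - inner ℝ x e ^ 2) * Real.exp (-(1 / 2 * ‖x‖ ^ 2))) : ℝ) : ℂ) := by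
  rw [autoConv_apply]
  simp only [hermiteTest_apply, Complex.conj_ofReal, ← Complex.ofReal_mul]
  rw [integral_complex_ofReal]
  congr 1
  rw [← integral_add_right_eq_self _ ((1 / 2 : ℝ) • x)]
  have h : ∀ u : V, inner ℝ (u + (1 / 2 : ℝ) • x) e * Real.exp (-‖u + (1 / 2 : ℝ) • x‖ ^ 2) *
      (inner ℝ (-(x - (u + (1 / 2 : ℝ) • x))) e *
        Real.exp (-‖-(x - (u + (1 / 2 : ℝ) • x))‖ ^ 2)) =
      Real.exp (-(1 / 2 * ‖x‖ ^ 2)) * (inner ℝ u e ^ 2 * Real.exp (-(2 * ‖u‖ ^ 2))) -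
      Real.exp (-(1 / 2 * ‖x‖ ^ 2)) * (inner ℝ x e ^ 2 / 4) * Real.exp (-(2 * ‖u‖ ^ 2)) := by
    intro u
    have e1 : -(x - (u + (1 / 2 : ℝ) • x)) = u - (1 / 2 : ℝ) • x := by module
    have e2 : Real.exp (-‖u + (1 / 2 : ℝ) • x‖ ^ 2) * Real.exp (-‖u - (1 / 2 : ℝ) • x‖ ^ 2) =
        Real.exp (-(1 / 2 * ‖x‖ ^ 2)) * Real.exp (-(2 * ‖u‖ ^ 2)) := by
      rw [← Real.exp_add, ← Real.exp_add, norm_add_sq_real, norm_sub_sq_real, norm_smul]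
      congr 1
      norm_num
      ring
    rw [e1, inner_add_left, inner_sub_left, inner_smul_left]
    simp only [conj_trivial]
    linear_combination (inner ℝ u e + 1 / 2 * inner ℝ x e) *
      (inner ℝ u e - 1 / 2 * inner ℝ x e) * e2
  simp only [h]
  rw [integral_sub ((integrable_inner_sq_mul_gaussian two_pos e).const_mul _)
    ((integrable_gaussian two_pos).const_mul _), integral_const_mul, integral_const_mul,
    integral_inner_sq_mul_gaussian two_pos, he]
  ring

/-- A positive definite function of degree `-2` satisfies a moment inequality in every
direction. -/
theorem moment_nonneg_of_isPositiveDefinite {f : V → ℝ}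
    (hf : IsPositiveDefiniteDistribution f) (hd : 3 ≤ Module.finrank ℝ V)
    (hom : ∀ r : ℝ, 0 < r → ∀ x, f (r • x) = (r ^ 2)⁻¹ * f x) {e : V} (he : ‖e‖ = 1) :
    0 ≤ ∫ θ : Metric.sphere (0 : V) 1,
      f θ * (1 - (Module.finrank ℝ V - 2 : ℕ) * inner ℝ (θ : V) e ^ 2) ∂sphereMeasure V := by
  have : Nontrivial V := Module.nontrivial_of_finrank_pos (R := ℝ) (by omega)
  obtain ⟨T, hT, hpd⟩ := hf
  obtain ⟨d, hdd⟩ : ∃ d, Module.finrank ℝ V = d + 3 := ⟨Module.finrank ℝ V - 3, by omega⟩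
  have hre := (hpd (hermiteTest e)).1
  obtain ⟨hfi, hval⟩ := hT (autoConv (hermiteTest e))
  set B := ∫ u : V, Real.exp (-(2 * ‖u‖ ^ 2)) with hB
  have hBpos : 0 < B := by
    rw [hB]
    exact integral_exp_pos (integrable_gaussian two_pos)
  have hfun : ∀ x, (f x : ℂ) * autoConv (hermiteTest e) x =
      ((f x * (B / 4 * ((1 - inner ℝ x e ^ 2) * Real.exp (-(1 / 2 * ‖x‖ ^ 2)))) : ℝ) : ℂ) := by
    intro x
    rw [autoConv_hermiteTest he]
    push_cast
    ring
  simp only [hfun] at hfi hval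
  rw [hval, integral_complex_ofReal, Complex.ofReal_re] at hre
  have hfi_re := hfi.re
  simp only [RCLike.re_to_complex, Complex.ofReal_re] at hfi_re
  rw [integral_eq_integral_sphere hfi_re] at hre
  have hM := radialMoment_pos (b := 1 / 2) (by norm_num) d
  have hrad : ∀ θ : Metric.sphere (0 : V) 1, (∫ r in Set.Ioi (0 : ℝ),
      r ^ (Module.finrank ℝ V - 1) • (f (r • (θ : V)) * (B / 4 *
        ((1 - inner ℝ (r • (θ : V)) e ^ 2) * Real.exp (-(1 / 2 * ‖r • (θ : V)‖ ^ 2)))))) =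
      B / 4 * radialMoment (1 / 2) d *
        (f θ * (1 - (Module.finrank ℝ V - 2 : ℕ) * inner ℝ (θ : V) e ^ 2)) := by
    intro θ
    have h1 : ∀ r ∈ Set.Ioi (0 : ℝ), r ^ (Module.finrank ℝ V - 1) • (f (r • (θ : V)) * (B / 4 *
        ((1 - inner ℝ (r • (θ : V)) e ^ 2) * Real.exp (-(1 / 2 * ‖r • (θ : V)‖ ^ 2))))) =
        f θ * (B / 4) * (r ^ d * Real.exp (-(1 / 2 * r ^ 2))) -
        f θ * (B / 4) * inner ℝ (θ : V) e ^ 2 *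
          (r ^ (d + 2) * Real.exp (-(1 / 2 * r ^ 2))) := by
      intro r hr
      have hr0 : r ≠ 0 := (Set.mem_Ioi.1 hr).ne'
      have e1 : Module.finrank ℝ V - 1 = d + 2 := by omega
      rw [hom r hr, inner_smul_left, norm_smul, e1]
      simp only [smul_eq_mul, conj_trivial, norm_eq_of_mem_sphere, mul_one, Real.norm_eq_abs,
        sq_abs]
      field_simp
      ring
    rw [setIntegral_congr_fun measurableSet_Ioi h1,
      integral_sub ((integrableOn_radialMoment (by norm_num) d).const_mul _)
        ((integrableOn_radialMoment (by norm_num) (d + 2)).const_mul _),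
      integral_const_mul, integral_const_mul]
    change _ * radialMoment (1 / 2) d - _ * radialMoment (1 / 2) (d + 2) = _
    rw [radialMoment_add_two (by norm_num)]
    have e2 : Module.finrank ℝ V - 2 = d + 1 := by omega
    rw [e2]
    push_cast
    ring
  simp only [hrad] at hre
  rw [integral_const_mul] at hre
  exact nonneg_of_mul_nonneg_right hre (by positivity)

end Gaussian

section NotPositiveDefinite

variable {n : ℕ}

/-- In dimension at least three not all the functions `bpFunction K` are positive definite. -/
theorem exists_not_isPositiveDefiniteDistribution (hn : 3 ≤ n) :
    ∃ K : ConvexBody (RSpace n), IsAdmissible K ∧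
      ¬ IsPositiveDefiniteDistribution (bpFunction (K : Set (RSpace n))) := by
  obtain ⟨m, rfl⟩ : ∃ m, n = m + 1 := ⟨n - 1, by omega⟩
  have hmR : (1 : ℝ) < m := by exact_mod_cast (by omega : 1 < m)
  let k : Fin (m + 1) := 0
  obtain ⟨c, hc, hneg⟩ := exists_integral_exp_mul_neg k hmR
  obtain ⟨ε, hε, h⟩ := exists_isAdmissible_axial k (p := fun s => Real.exp (-(c * s)))
    (fun s _ => by
      have : ContDiff ℝ 2 fun s => Real.exp (-(c * s)) := by fun_prop
      exact this.contDiffAt) (fun s _ => Real.exp_pos _)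
  obtain ⟨K, hK, hF⟩ := h ε hε le_rfl
  refine ⟨K, hK, fun hpd => ?_⟩
  have hfr := finrank_RSpace (m + 1)
  have hmom : ∀ p : Fin (m + 1) × Fin 2, 0 ≤ ∫ θ : Metric.sphere (0 : RSpace (m + 1)) 1,
      bpFunction (K : Set (RSpace (m + 1))) θ * (1 - 2 * m * (θ : RSpace (m + 1)) p ^ 2)
        ∂sphereMeasure (RSpace (m + 1)) := by
    intro p
    have := moment_nonneg_of_isPositiveDefinite hpd (by omega)
      (fun r hr x => bpFunction_smul _ hr x) (e := EuclideanSpace.single p (1 : ℝ)) (by simp)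
    have e1 : Module.finrank ℝ (RSpace (m + 1)) - 2 = 2 * m := by omega
    simp only [inner_single, e1] at this
    push_cast at this
    exact this
  have hcK := continuous_bpFunction_sphere hK
  have hsum := add_nonneg (hmom (k, 0)) (hmom (k, 1))
  rw [← integral_add (integrable_sphere (by fun_prop)) (integrable_sphere (by fun_prop))] at hsum
  have heq : ∀ θ : Metric.sphere (0 : RSpace (m + 1)) 1,
      bpFunction (K : Set (RSpace (m + 1))) θ * (1 - 2 * m * (θ : RSpace (m + 1)) (k, 0) ^ 2) +
      bpFunction (K : Set (RSpace (m + 1))) θ * (1 - 2 * m * (θ : RSpace (m + 1)) (k, 1) ^ 2) =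
      2 * ε⁻¹ * (Real.exp (c * ‖coordMap k θ‖ ^ 2) * (1 - m * ‖coordMap k θ‖ ^ 2)) := by
    intro θ
    rw [hF θ (by simp), mul_inv, Real.exp_neg, inv_inv, norm_sq_coordMap]
    ring
  simp only [heq] at hsum
  rw [integral_const_mul] at hsum
  have := mul_neg_of_pos_of_neg (by positivity : 0 < 2 * ε⁻¹) hneg
  linarith

end NotPositiveDefinite

section Rotation

variable {n : ℕ}

/-- Multiplication by a complex scalar. -/
def cmul (z : ℂ) (x : RSpace n) : RSpace n := z.re • x + z.im • perp x

theorem rot_eq_cmul (t : ℝ) (x : RSpace n) :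
    rot t x = cmul (Complex.exp (t * Complex.I)) x := by
  ext p
  obtain ⟨k, i⟩ := p
  fin_cases i <;>
    simp [rot, cmul, perp, Complex.exp_ofReal_mul_I_re, Complex.exp_ofReal_mul_I_im] <;> ring

theorem norm_cmul (z : ℂ) (x : RSpace n) : ‖cmul z x‖ = ‖z‖ * ‖x‖ := by
  rw [← sq_eq_sq₀ (norm_nonneg _) (by positivity), cmul, norm_add_sq_real, mul_pow,
    Complex.sq_norm, Complex.normSq_apply, norm_smul, norm_smul, norm_perp, inner_smul_left,
    inner_smul_right, inner_perp, mul_pow, mul_pow, Real.norm_eq_abs, Real.norm_eq_abs, sq_abs,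
    sq_abs]
  simp
  ring

theorem cmul_smul (r : ℝ) (z : ℂ) (x : RSpace n) : cmul (r • z) x = r • cmul z x := by
  simp [cmul, smul_smul]

theorem perp_add (x y : RSpace n) : perp (x + y) = perp x + perp y := by
  ext p
  obtain ⟨k, i⟩ := p
  fin_cases i <;> simp [perp]
  ring

theorem perp_smul (r : ℝ) (x : RSpace n) : perp (r • x) = r • perp x := by
  ext p
  obtain ⟨k, i⟩ := p
  fin_cases i <;> simp [perp]

theorem continuous_perp : Continuous (perp : RSpace n → RSpace n) := by
  let L : RSpace n →ₗ[ℝ] RSpace n :=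
    { toFun := perp
      map_add' := perp_add
      map_smul' := perp_smul }
  exact L.continuous_of_finiteDimensional

theorem continuous_cmul : Continuous fun q : ℂ × RSpace n => cmul q.1 q.2 := by
  have := continuous_perp (n := n)
  unfold cmul
  fun_prop

/-- Multiples of a fixed unit vector by complex scalars. -/
def complexLine (x : RSpace n) (hx : ‖x‖ = 1) : ℂ →ₗᵢ[ℝ] RSpace n where
  toFun z := cmul z x
  map_add' z w := by
    simp only [cmul, Complex.add_re, Complex.add_im]
    module
  map_smul' r z := cmul_smul r z x
  norm_map' z := by
    show ‖cmul z x‖ = ‖z‖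
    rw [norm_cmul, hx, mul_one]

/-- Multiplication by a complex number of modulus one, as an isometry. -/
def cmulIsometry (u : ℂ) (hu : ‖u‖ = 1) : RSpace n ≃ₗᵢ[ℝ] RSpace n :=
  LinearIsometry.toLinearIsometryEquiv
    { toFun := fun x => cmul u x
      map_add' := fun x y => by
        simp only [cmul, perp_add]
        module
      map_smul' := fun r x => by
        simp only [cmul, perp_smul, RingHom.id_apply]
        module
      norm_map' := fun x => by
        show ‖cmul u x‖ = ‖x‖
        rw [norm_cmul, hu, one_mul] } rfl

variable {K : ConvexBody (RSpace n)}

theorem gauge_cmul (hK : IsAdmissible K) {u : ℂ} (hu : ‖u‖ = 1) (x : RSpace n) :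
    gauge (K : Set (RSpace n)) (cmul u x) = gauge (K : Set (RSpace n)) x := by
  set t := toIcoMod Real.two_pi_pos 0 u.arg with ht
  have hmem : t ∈ Set.Icc (0 : ℝ) (2 * Real.pi) := by
    have := toIcoMod_mem_Ico Real.two_pi_pos 0 u.arg
    rw [zero_add] at this
    exact ⟨this.1, this.2.le⟩
  have hexp : Complex.exp (t * Complex.I) = u := by
    have h1 : t = u.arg - toIcoDiv Real.two_pi_pos 0 u.arg * (2 * Real.pi) := by
      rw [ht, toIcoMod, zsmul_eq_mul]
    have h2 := Complex.norm_mul_exp_arg_mul_I u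
    rw [hu, Complex.ofReal_one, one_mul] at h2
    rw [h1]
    push_cast
    rw [sub_mul, Complex.exp_sub, h2]
    have : Complex.exp (toIcoDiv Real.two_pi_pos 0 u.arg * (2 * Real.pi) * Complex.I) = 1 := by
      rw [mul_assoc]
      exact Complex.exp_int_mul_two_pi_mul_I _
    rw [this, div_one]
  have := hK.rotInvariant t hmem x
  rwa [rot_eq_cmul, hexp] at this

theorem bpFunction_cmul (hK : IsAdmissible K) {u : ℂ} (hu : ‖u‖ = 1) (x : RSpace n) :
    bpFunction (K : Set (RSpace n)) (cmul u x) = bpFunction (K : Set (RSpace n)) x := by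
  unfold bpFunction
  rw [gauge_cmul hK hu, norm_cmul, hu, one_mul]

end Rotation

section TwoDimensional

theorem perp_mem_hyperplane {n : ℕ} {ξ η : RSpace n} (h : η ∈ hyperplane ξ) :
    perp η ∈ hyperplane ξ := by
  rw [mem_hyperplane_iff] at h ⊢
  have e : ∀ k, toComplex (perp η) k = Complex.I * toComplex η k := by
    intro k
    apply Complex.ext <;> simp [toComplex, perp]
  simp only [e, mul_assoc, ← Finset.mul_sum, h, mul_zero]

/-- In complex dimension two every complex line is a hyperplane. -/
theorem exists_mem_hyperplane (η : RSpace 2) (hη : ‖η‖ = 1) :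
    ∃ ξ : RSpace 2, ‖ξ‖ = 1 ∧ η ∈ hyperplane ξ := by
  let ξ : RSpace 2 := WithLp.toLp 2 fun p => match p with
    | (0, 0) => -η (1, 0)
    | (0, 1) => η (1, 1)
    | (1, 0) => η (0, 0)
    | (1, 1) => -η (0, 1)
  refine ⟨ξ, ?_, ?_⟩
  · rw [← hη, ← sq_eq_sq₀ (norm_nonneg _) (norm_nonneg _), norm_sq_eq, norm_sq_eq]
    simp [Fin.sum_univ_two, ξ]
    ring
  · rw [mem_hyperplane_iff]
    apply Complex.ext <;> simp [Fin.sum_univ_two, ξ, toComplex] <;> ring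

theorem exists_cmul_eq {ξ η x : RSpace 2} (hξ : ‖ξ‖ = 1) (hη : ‖η‖ = 1) (hηξ : η ∈ hyperplane ξ)
    (hx : x ∈ hyperplane ξ) : ∃ z : ℂ, x = cmul z η := by
  have hle : Submodule.span ℝ {η, perp η} ≤ hyperplane ξ := by
    rw [Submodule.span_le]
    rintro y (rfl | rfl)
    · exact hηξ
    · exact perp_mem_hyperplane hηξ
  have hfr : Module.finrank ℝ (Submodule.span ℝ {η, perp η}) = 2 := by
    have h1 := finrank_hyperplane hη
    have h2 := Submodule.finrank_add_finrank_orthogonal (Submodule.span ℝ {η, perp η})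
    rw [finrank_RSpace] at h2
    unfold hyperplane at h1
    omega
  have heq : Submodule.span ℝ {η, perp η} = hyperplane ξ :=
    Submodule.eq_of_le_of_finrank_eq hle (by rw [hfr, finrank_hyperplane hξ])
  rw [← heq] at hx
  obtain ⟨a, b, rfl⟩ := Submodule.mem_span_pair.1 hx
  exact ⟨⟨a, b⟩, rfl⟩

/-- In complex dimension two the volume of a section determines the radial function. -/
theorem hvolSection_two {K : ConvexBody (RSpace 2)} (hK : IsAdmissible K) {ξ η : RSpace 2}
    (hξ : ‖ξ‖ = 1) (hη : ‖η‖ = 1) (hηξ : η ∈ hyperplane ξ) :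
    hvolSection (K : Set (RSpace 2)) ξ =
      ENNReal.ofReal (4 * ((sphereMeasure (hyperplane ξ)).real Set.univ *
        bpFunction (K : Set (RSpace 2)) η)) := by
  rw [hvolSection_eq le_rfl hK hξ]
  have : ∀ θ : Metric.sphere (0 : hyperplane ξ) 1,
      bpFunction (K : Set (RSpace 2)) ((θ : hyperplane ξ) : RSpace 2) =
        bpFunction (K : Set (RSpace 2)) η := by
    intro θ
    obtain ⟨z, hz⟩ := exists_cmul_eq hξ hη hηξ (θ : hyperplane ξ).2
    have hθ : ‖((θ : hyperplane ξ) : RSpace 2)‖ = 1 := mem_sphere_zero_iff_norm.1 θ.2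
    have hz1 : ‖z‖ = 1 := by
      rw [hz, norm_cmul, hη, mul_one] at hθ
      exact hθ
    rw [hz, bpFunction_cmul hK hz1]
  simp only [this, integral_const, smul_eq_mul]
  congr 2 <;> norm_num

theorem busemannPettyAffirmative_two : BusemannPettyAffirmative 2 := by
  intro K L hK hL h
  have hle : ∀ η : RSpace 2, ‖η‖ = 1 →
      bpFunction (K : Set (RSpace 2)) η ≤ bpFunction (L : Set (RSpace 2)) η := by
    intro η hη
    obtain ⟨ξ, hξ, hηξ⟩ := exists_mem_hyperplane η hη
    have := h ξ hξ
    have hη0 : η ≠ 0 := by rintro rfl; simp at hη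
    rw [hvolSection_two hK hξ hη hηξ, hvolSection_two hL hξ hη hηξ,
      ENNReal.ofReal_le_ofReal_iff (mul_nonneg (by norm_num) (mul_nonneg measureReal_nonneg
        (bpFunction_pos hL hη0).le))] at this
    have hne : sphereMeasure (hyperplane ξ) ≠ 0 := by
      rw [sphereMeasure, Ne, Measure.toSphere_eq_zero_iff_finrank, finrank_hyperplane hξ]
      norm_num
    have hpos : 0 < (sphereMeasure (hyperplane ξ)).real Set.univ := by
      rw [measureReal_def, ENNReal.toReal_pos_iff]
      exact ⟨by rwa [Measure.measure_univ_pos], measure_lt_top _ _⟩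
    exact le_of_mul_le_mul_left (le_of_mul_le_mul_left this (by norm_num)) hpos
  rw [hvol_eq two_pos hK, hvol_eq two_pos hL]
  refine ENNReal.ofReal_le_ofReal (mul_le_mul_of_nonneg_left ?_ (by positivity))
  refine integral_mono (integrable_sphere ((continuous_bpFunction_sphere hK).pow 2))
    (integrable_sphere ((continuous_bpFunction_sphere hL).pow 2)) fun θ => ?_
  exact pow_le_pow_left₀ (bpFunction_pos hK (ne_zero_of_mem_unit_sphere θ)).le
    (hle θ (by simp)) 2

end TwoDimensional

section SubspacePositivity

variable {V : Type*} [NormedAddCommGroup V] [InnerProductSpace ℝ V]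

theorem exists_norm_le_inv_pow (φ : 𝓢(V, ℂ)) (N : ℕ) :
    ∃ C, 0 ≤ C ∧ ∀ x, ‖φ x‖ ≤ C * ((1 + ‖x‖) ^ N)⁻¹ := by
  refine ⟨2 ^ N * (Finset.Iic (N, 0)).sup (schwartzSeminormFamily ℝ V ℂ) φ, by positivity,
    fun x => ?_⟩
  have := SchwartzMap.one_add_le_sup_seminorm_apply (𝕜 := ℝ) (m := (N, 0)) le_rfl le_rfl φ x
  rw [norm_iteratedFDeriv_zero] at this
  rw [← div_eq_mul_inv, le_div_iff₀ (by positivity), mul_comm]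
  exact this

variable [FiniteDimensional ℝ V] [MeasurableSpace V] [BorelSpace V]

theorem integrable_inv_one_add_norm_pow :
    Integrable fun x : V => ((1 + ‖x‖) ^ (Module.finrank ℝ V + 1))⁻¹ := by
  have := integrable_one_add_norm (E := V) (μ := volume) (r := (Module.finrank ℝ V + 1 : ℕ))
    (by push_cast; linarith)
  refine this.congr (Filter.Eventually.of_forall fun x => ?_)
  dsimp only
  rw [Real.rpow_neg (by positivity), Real.rpow_natCast]

theorem measurePreserving_add_orthogonal (H : Submodule ℝ V) :
    MeasurePreserving (fun p : H × Hᗮ => (p.1 : V) + (p.2 : V)) (volume.prod volume) volume := by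
  have h1 : MeasurePreserving (WithLp.toLp 2 : H × Hᗮ → WithLp 2 (H × Hᗮ))
    (volume.prod volume) volume := WithLp.volume_preserving_toLp H Hᗮ
  have h2 := (H.orthogonalDecomposition).symm.measurePreserving
  have he : (fun p : H × Hᗮ => (p.1 : V) + (p.2 : V)) =
      H.orthogonalDecomposition.symm ∘ WithLp.toLp 2 := by
    funext p
    simp
  rw [he]
  exact h2.comp h1

theorem measurableEmbedding_add_orthogonal (H : Submodule ℝ V) :
    MeasurableEmbedding (fun p : H × Hᗮ => (p.1 : V) + (p.2 : V)) := by
  refine Continuous.measurableEmbedding (by fun_prop) ?_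
  intro p q h
  have h' : (p.1 : V) - q.1 = q.2 - p.2 := by
    have : (p.1 : V) + p.2 = q.1 + q.2 := h
    rw [sub_eq_sub_iff_add_eq_add, this]
    abel
  have h0 : (p.1 : V) - q.1 = 0 := by
    have hH : (p.1 : V) - q.1 ∈ H := H.sub_mem p.1.2 q.1.2
    have hO : (p.1 : V) - q.1 ∈ Hᗮ := by
      rw [h']
      exact Hᗮ.sub_mem q.2.2 p.2.2
    have : (p.1 : V) - q.1 ∈ H ⊓ Hᗮ := ⟨hH, hO⟩
    rwa [Submodule.inf_orthogonal_eq_bot, Submodule.mem_bot] at this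
  have h1 : (q.2 : V) - p.2 = 0 := by rw [← h', h0]
  exact Prod.ext (Subtype.ext (sub_eq_zero.1 h0)) (Subtype.ext (sub_eq_zero.1 h1).symm)

theorem integrable_shear (φ : 𝓢(V, ℂ)) (H : Submodule ℝ V) :
    Integrable (fun q : H × V => φ q.2 * conj (φ (q.2 - q.1))) (volume.prod volume) := by
  set N := Module.finrank ℝ H + 1 with hN
  obtain ⟨C, hC, hφ⟩ := exists_norm_le_inv_pow φ N
  let a : H → ℝ := fun h => ((1 + ‖h‖) ^ N)⁻¹
  have ha : Integrable a := integrable_inv_one_add_norm_pow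
  have hac : Continuous a := by
    refine Continuous.inv₀ (by fun_prop) fun h => ?_
    positivity
  have ha0 : ∀ h, 0 ≤ a h := fun h => by positivity
  let P : V → H := fun y => H.orthogonalProjectionOnto y
  have hP : Continuous P := by fun_prop
  have hφc := φ.continuous
  have hbd : Integrable (fun q : H × V => ‖φ q.2‖ * a (P q.2 - q.1)) (volume.prod volume) := by
    rw [integrable_prod_iff' (Continuous.aestronglyMeasurable (by fun_prop))]
    constructor
    · exact Filter.Eventually.of_forall fun y => (ha.comp_sub_left (P y)).const_mul ‖φ y‖
    · have : ∀ y, ∫ h : H, ‖‖φ y‖ * a (P y - h)‖ = ‖φ y‖ * ∫ h, a h := by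
        intro y
        simp only [norm_mul, norm_norm, Real.norm_of_nonneg (ha0 _)]
        rw [integral_const_mul, integral_sub_left_eq_self a volume (P y)]
      simp only [this]
      exact φ.integrable.norm.mul_const _
  refine (hbd.const_mul C).mono' (Continuous.aestronglyMeasurable (by fun_prop))
    (Filter.Eventually.of_forall fun q => ?_)
  have h1 : ‖φ (q.2 - q.1)‖ ≤ C * a (P q.2 - q.1) := by
    refine (hφ _).trans (mul_le_mul_of_nonneg_left ?_ hC)
    have h2 : ‖P q.2 - q.1‖ ≤ ‖q.2 - (q.1 : V)‖ := by
      have e : P q.2 - q.1 = H.orthogonalProjectionOnto (q.2 - (q.1 : V)) := by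
        rw [map_sub, Submodule.orthogonalProjectionOnto_mem_subspace_eq_self]
      rw [e]
      exact Submodule.norm_orthogonalProjectionOnto_apply_le _ _
    simp only [a]
    gcongr
  rw [norm_mul, RCLike.norm_conj]
  calc ‖φ q.2‖ * ‖φ (q.2 - q.1)‖ ≤ ‖φ q.2‖ * (C * a (P q.2 - q.1)) := by gcongr
    _ = _ := by ring

/-- The integral of `φ ∗ conj φ(-·)` over a subspace is the squared norm of the function obtained
by integrating `φ` over the cosets of the subspace. -/
theorem integral_autoConv_submodule (φ : 𝓢(V, ℂ)) (H : Submodule ℝ V) :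
    ∫ h : H, autoConv φ h =
      ((∫ w : Hᗮ, ‖∫ h : H, φ (h + w)‖ ^ 2 : ℝ) : ℂ) := by
  have hfi := integrable_shear φ H
  calc ∫ h : H, autoConv φ h = ∫ h : H, ∫ y, φ y * conj (φ (y - h)) := by
        congr 1
        funext h
        rw [autoConv_apply]
        simp only [neg_sub]
    _ = ∫ y, ∫ h : H, φ y * conj (φ (y - h)) := integral_integral_swap hfi
    _ = ∫ p : H × Hᗮ, (∫ h : H, φ (p.1 + p.2) * conj (φ (p.1 + p.2 - h)))
          ∂(volume.prod volume) :=
        ((measurePreserving_add_orthogonal H).integral_comp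
          (measurableEmbedding_add_orthogonal H)
          (fun y => ∫ h : H, φ y * conj (φ (y - h)))).symm
    _ = ∫ p : H × Hᗮ, φ (p.1 + p.2) * conj (∫ h : H, φ (h + p.2))
          ∂(volume.prod volume) := by
        congr 1
        funext p
        rw [integral_const_mul, integral_conj,
          ← integral_sub_left_eq_self (fun h : H => φ (h + p.2)) volume p.1]
        congr 3
        funext h
        congr 1
        push_cast
        abel
    _ = ∫ w : Hᗮ, ∫ k : H, φ (k + w) * conj (∫ h : H, φ (h + w)) := by
        rw [integral_prod_symm]
        have h2 : Integrable fun y => ∫ h : H, φ y * conj (φ (y - h)) := hfi.integral_prod_right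
        have h3 := ((measurePreserving_add_orthogonal H).integrable_comp_emb
          (measurableEmbedding_add_orthogonal H)).2 h2
        refine h3.congr (Filter.Eventually.of_forall fun p => ?_)
        simp only [Function.comp_apply]
        rw [integral_const_mul, integral_conj,
          ← integral_sub_left_eq_self (fun h : H => φ (h + p.2)) volume p.1]
        congr 3
        funext h
        congr 1
        push_cast
        abel
    _ = _ := by
        rw [← integral_complex_ofReal]
        congr 1
        funext w
        rw [integral_mul_const, Complex.mul_conj, Complex.normSq_eq_norm_sq]

theorem exists_integral_autoConv_isometry {E : Type*} [NormedAddCommGroup E]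
    [InnerProductSpace ℝ E] [FiniteDimensional ℝ E] [MeasurableSpace E] [BorelSpace E]
    (φ : 𝓢(V, ℂ)) (ι : E →ₗᵢ[ℝ] V) :
    ∃ j : ℝ, 0 ≤ j ∧ ∫ z, autoConv φ (ι z) = (j : ℂ) := by
  let H := LinearMap.range ι.toLinearMap
  refine ⟨∫ w : Hᗮ, ‖∫ h : H, φ (h + w)‖ ^ 2, integral_nonneg fun _ => sq_nonneg _, ?_⟩
  rw [← integral_autoConv_submodule φ H]
  exact ι.equivRange.measurePreserving.integral_comp
    ι.equivRange.toHomeomorph.measurableEmbedding (fun h : H => autoConv φ h)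

end SubspacePositivity

section RadialIntegral

variable {V : Type*} [NormedAddCommGroup V] [InnerProductSpace ℝ V]

/-- The integral of `r ψ (r x)` over the ray through `x`. -/
def rayIntegral (ψ : 𝓢(V, ℂ)) (x : V) : ℂ := ∫ r in Set.Ioi (0 : ℝ), r • ψ (r • x)

theorem exists_ray_bound (ψ : 𝓢(V, ℂ)) :
    ∃ C, ∀ x : V, ‖x‖ = 1 → ∀ r : ℝ, 0 < r → ‖r • ψ (r • x)‖ ≤ C * (1 + r ^ 2)⁻¹ := by
  obtain ⟨C, hC, hψ⟩ := exists_norm_le_inv_pow ψ 3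
  refine ⟨C, fun x hx r hr => ?_⟩
  have h := hψ (r • x)
  rw [norm_smul, hx, mul_one, Real.norm_of_nonneg hr.le] at h
  rw [norm_smul, Real.norm_of_nonneg hr.le]
  calc r * ‖ψ (r • x)‖ ≤ r * (C * ((1 + r) ^ 3)⁻¹) := by gcongr
    _ = C * (r * ((1 + r) ^ 3)⁻¹) := by ring
    _ ≤ C * (1 + r ^ 2)⁻¹ := by
        refine mul_le_mul_of_nonneg_left ?_ hC
        rw [← div_eq_mul_inv, div_le_iff₀ (by positivity), ← div_eq_inv_mul,
          le_div_iff₀ (by positivity)]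
        nlinarith [sq_nonneg r]

theorem continuous_rayIntegral {X : Type*} [TopologicalSpace X] [FirstCountableTopology X]
    (ψ : 𝓢(V, ℂ)) {g : X → V} (hg : Continuous g) (hg1 : ∀ x, ‖g x‖ = 1) :
    Continuous fun x => rayIntegral ψ (g x) := by
  obtain ⟨C, hC⟩ := exists_ray_bound ψ
  have hψ := ψ.continuous
  unfold rayIntegral
  refine continuous_of_dominated (bound := fun r => C * (1 + r ^ 2)⁻¹) (fun x => ?_) (fun x => ?_)
    (integrable_inv_one_add_sq.const_mul C).integrableOn (Filter.Eventually.of_forall fun r => ?_)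
  · exact Continuous.aestronglyMeasurable (by fun_prop)
  · filter_upwards [ae_restrict_mem measurableSet_Ioi] with r hr
    exact hC _ (hg1 x) r hr
  · fun_prop

end RadialIntegral

section TwoDimensionalPositivity

variable {n : ℕ}

theorem integral_complexLine (ψ : 𝓢(RSpace n, ℂ)) {x : RSpace n} (hx : ‖x‖ = 1) :
    ∫ z : ℂ, ψ (complexLine x hx z) =
      ∫ u : Metric.sphere (0 : ℂ) 1, rayIntegral ψ (cmul u x) ∂sphereMeasure ℂ := by
  have hfi : Integrable fun z : ℂ => ψ (complexLine x hx z) := by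
    obtain ⟨C, hC, hψ⟩ := exists_norm_le_inv_pow ψ (Module.finrank ℝ ℂ + 1)
    refine (integrable_inv_one_add_norm_pow.const_mul C).mono'
      (ψ.continuous.comp (complexLine x hx).continuous).aestronglyMeasurable
      (Filter.Eventually.of_forall fun z => ?_)
    have := hψ (complexLine x hx z)
    rwa [LinearIsometry.norm_map] at this
  rw [integral_eq_integral_sphere hfi]
  congr 1
  funext u
  unfold rayIntegral
  congr 1
  funext r
  rw [Complex.finrank_real_complex, map_smul, pow_one]
  rfl

variable {K : ConvexBody (RSpace n)}

theorem measurable_bpFunction (hK : IsAdmissible K) :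
    Measurable (bpFunction (K : Set (RSpace n))) := by
  have := hK.continuous_gauge.measurable
  unfold bpFunction
  fun_prop

theorem bpFunction_nonneg (hK : IsAdmissible K) (x : RSpace n) :
    0 ≤ bpFunction (K : Set (RSpace n)) x := by
  by_cases hx : x = 0
  · simp [hx, bpFunction]
  · exact (bpFunction_pos hK hx).le

theorem exists_bpFunction_le (hK : IsAdmissible K) :
    ∃ C, 0 ≤ C ∧ ∀ x, bpFunction (K : Set (RSpace n)) x ≤ C * (‖x‖ ^ 2)⁻¹ := by
  obtain ⟨C, hC⟩ := isCompact_univ.exists_bound_of_continuousOn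
    (continuous_bpFunction_sphere hK).continuousOn
  refine ⟨max C 0, le_max_right _ _, fun x => ?_⟩
  by_cases hx : x = 0
  · simp [hx, bpFunction]
  · have hx0 : 0 < ‖x‖ := norm_pos_iff.2 hx
    have h1 : bpFunction (K : Set (RSpace n)) x =
        (‖x‖ ^ 2)⁻¹ * bpFunction (K : Set (RSpace n)) (‖x‖⁻¹ • x) := by
      rw [← bpFunction_smul _ hx0, smul_smul, mul_inv_cancel₀ hx0.ne', one_smul]
    rw [h1, mul_comm]
    refine mul_le_mul_of_nonneg_right ?_ (by positivity)
    have := hC ⟨‖x‖⁻¹ • x, by simp [norm_smul, hx0.ne']⟩ (Set.mem_univ _)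
    exact ((le_abs_self _).trans this).trans (le_max_left _ _)

theorem integrable_bpFunction_mul_decay {K : ConvexBody (RSpace 2)} (hK : IsAdmissible K) :
    Integrable fun x : RSpace 2 => bpFunction (K : Set (RSpace 2)) x * ((1 + ‖x‖) ^ 3)⁻¹ := by
  obtain ⟨C, hC, hle⟩ := exists_bpFunction_le hK
  have hfr := finrank_RSpace 2
  have hmaj : Integrable fun x : RSpace 2 => C * (‖x‖ ^ 2)⁻¹ * ((1 + ‖x‖) ^ 3)⁻¹ := by
    rw [integrable_fun_norm_addHaar volume
      (f := fun y : ℝ => C * (y ^ 2)⁻¹ * ((1 + y) ^ 3)⁻¹), hfr]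
    refine Integrable.mono' (integrable_inv_one_add_sq.const_mul C).integrableOn
      (Measurable.aestronglyMeasurable (by fun_prop)) ?_
    filter_upwards [ae_restrict_mem measurableSet_Ioi] with r hr
    have hr' : 0 < r := hr
    rw [Real.norm_of_nonneg (by simp only [smul_eq_mul]; positivity)]
    have e : r ^ (2 * 2 - 1) • (C * (r ^ 2)⁻¹ * ((1 + r) ^ 3)⁻¹) = C * (r * ((1 + r) ^ 3)⁻¹) := by
      rw [show 2 * 2 - 1 = 3 from rfl, smul_eq_mul]
      field_simp
    rw [e]
    refine mul_le_mul_of_nonneg_left ?_ hC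
    rw [← div_eq_mul_inv, div_le_iff₀ (by positivity), ← div_eq_inv_mul,
      le_div_iff₀ (by positivity)]
    nlinarith [sq_nonneg r]
  have hm := measurable_bpFunction hK
  refine hmaj.mono' (Measurable.aestronglyMeasurable (by fun_prop))
    (Filter.Eventually.of_forall fun x => ?_)
  have := bpFunction_nonneg hK x
  rw [Real.norm_of_nonneg (by positivity)]
  exact mul_le_mul_of_nonneg_right (hle x) (by positivity)

theorem exists_represents_bpFunction {K : ConvexBody (RSpace 2)} (hK : IsAdmissible K) :
    ∃ T : 𝓢'(RSpace 2, ℂ), Represents (bpFunction (K : Set (RSpace 2))) T := by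
  set f := bpFunction (K : Set (RSpace 2)) with hf
  have hm : Measurable fun x => (f x).toNNReal := (measurable_bpFunction hK).real_toNNReal
  have hcoe : ∀ x, (((f x).toNNReal : NNReal) : ℝ) = f x := fun x =>
    Real.coe_toNNReal _ (bpFunction_nonneg hK x)
  let μ : Measure (RSpace 2) := volume.withDensity fun x => ((f x).toNNReal : ENNReal)
  have hμ : μ.HasTemperateGrowth := by
    refine ⟨⟨3, ?_⟩⟩
    rw [integrable_withDensity_iff_integrable_smul hm]
    refine (integrable_bpFunction_mul_decay hK).congr (Filter.Eventually.of_forall fun x => ?_)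
    dsimp only
    rw [NNReal.smul_def, hcoe, smul_eq_mul, Real.rpow_neg (by positivity), Real.rpow_natCast]
  refine ⟨μ.toTemperedDistribution, fun φ => ?_⟩
  have hfun : (fun x => (f x : ℂ) * φ x) = fun x => (f x).toNNReal • φ x := by
    funext x
    rw [NNReal.smul_def, hcoe, Complex.real_smul]
  constructor
  · rw [hfun, ← integrable_withDensity_iff_integrable_smul hm]
    exact φ.integrable
  · rw [hfun, Measure.toTemperedDistribution_apply μ, integral_withDensity_eq_integral_smul hm]

/-- In complex dimension two, `bpFunction K` is a superposition of measures on complex lines. -/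
theorem integral_bpFunction_mul_two {K : ConvexBody (RSpace 2)} (hK : IsAdmissible K)
    (ψ : 𝓢(RSpace 2, ℂ))
    (hfi : Integrable fun x => (bpFunction (K : Set (RSpace 2)) x : ℂ) * ψ x) :
    (sphereMeasure ℂ).real Set.univ • ∫ x, (bpFunction (K : Set (RSpace 2)) x : ℂ) * ψ x =
      ∫ θ : Metric.sphere (0 : RSpace 2) 1, (bpFunction (K : Set (RSpace 2)) θ : ℂ) *
        (∫ z : ℂ, ψ (complexLine (θ : RSpace 2) (by simp) z)) ∂sphereMeasure (RSpace 2) := by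
  set f := bpFunction (K : Set (RSpace 2)) with hf
  have hpolar : ∫ x, (f x : ℂ) * ψ x =
      ∫ θ : Metric.sphere (0 : RSpace 2) 1, (f θ : ℂ) * rayIntegral ψ θ
        ∂sphereMeasure (RSpace 2) := by
    rw [integral_eq_integral_sphere hfi, finrank_RSpace]
    congr 1
    funext θ
    unfold rayIntegral
    rw [← integral_const_mul]
    refine setIntegral_congr_fun measurableSet_Ioi fun r hr => ?_
    have hr0 : (r : ℂ) ≠ 0 := Complex.ofReal_ne_zero.2 (Set.mem_Ioi.1 hr).ne'
    rw [hf, bpFunction_smul _ hr, Complex.real_smul, Complex.real_smul]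
    push_cast
    field_simp
  have hcont : Continuous fun q : Metric.sphere (0 : RSpace 2) 1 × Metric.sphere (0 : ℂ) 1 =>
      (f q.1 : ℂ) * rayIntegral ψ (cmul (q.2 : ℂ) (q.1 : RSpace 2)) := by
    refine Continuous.mul ?_ ?_
    · exact Complex.continuous_ofReal.comp
        ((continuous_bpFunction_sphere hK).comp continuous_fst)
    · refine continuous_rayIntegral ψ
        (g := fun q : Metric.sphere (0 : RSpace 2) 1 × Metric.sphere (0 : ℂ) 1 =>
          cmul (q.2 : ℂ) (q.1 : RSpace 2)) ?_ fun q => by simp [norm_cmul]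
      exact continuous_cmul.comp (by fun_prop :
        Continuous fun q : Metric.sphere (0 : RSpace 2) 1 × Metric.sphere (0 : ℂ) 1 =>
          ((q.2 : ℂ), (q.1 : RSpace 2)))
  have hinv : ∀ u : Metric.sphere (0 : ℂ) 1,
      ∫ θ : Metric.sphere (0 : RSpace 2) 1, (f θ : ℂ) * rayIntegral ψ (cmul (u : ℂ) θ)
        ∂sphereMeasure (RSpace 2) =
      ∫ θ : Metric.sphere (0 : RSpace 2) 1, (f θ : ℂ) * rayIntegral ψ θ
        ∂sphereMeasure (RSpace 2) := by
    intro u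
    have hu : ‖(u : ℂ)‖ = 1 := by simp
    rw [← integral_sphereMap (cmulIsometry (u : ℂ) hu)
      fun θ : Metric.sphere (0 : RSpace 2) 1 => (f θ : ℂ) * rayIntegral ψ θ]
    congr 1
    funext θ
    show _ = (f (cmul (u : ℂ) (θ : RSpace 2)) : ℂ) * rayIntegral ψ (cmul (u : ℂ) (θ : RSpace 2))
    rw [hf, bpFunction_cmul hK hu]
  simp only [integral_complexLine, ← integral_const_mul]
  rw [integral_integral_swap (hcont.integrable_of_hasCompactSupport
    (HasCompactSupport.of_compactSpace _))]
  simp only [hinv, integral_const]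
  rw [hpolar]

theorem isPositiveDefiniteDistribution_two {K : ConvexBody (RSpace 2)} (hK : IsAdmissible K) :
    IsPositiveDefiniteDistribution (bpFunction (K : Set (RSpace 2))) := by
  obtain ⟨T, hT⟩ := exists_represents_bpFunction hK
  refine ⟨T, hT, fun φ => ?_⟩
  obtain ⟨hfi, hval⟩ := hT (autoConv φ)
  have h := integral_bpFunction_mul_two hK (autoConv φ) hfi
  rw [← hval] at h
  have hline : ∀ θ : Metric.sphere (0 : RSpace 2) 1, ∃ j : ℝ, 0 ≤ j ∧
      ∫ z : ℂ, autoConv φ (complexLine (θ : RSpace 2) (by simp) z) = (j : ℂ) := fun θ =>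
    exists_integral_autoConv_isometry φ (complexLine (θ : RSpace 2) (by simp))
  choose j hj0 hj using hline
  simp only [hj, ← Complex.ofReal_mul] at h
  rw [integral_complex_ofReal] at h
  have hJ : 0 ≤ ∫ θ : Metric.sphere (0 : RSpace 2) 1,
      bpFunction (K : Set (RSpace 2)) θ * j θ ∂sphereMeasure (RSpace 2) :=
    integral_nonneg fun θ => mul_nonneg (bpFunction_nonneg hK _) (hj0 θ)
  have hpos : 0 < (sphereMeasure ℂ).real Set.univ := by
    rw [measureReal_def, ENNReal.toReal_pos_iff]
    exact ⟨by rw [Measure.measure_univ_pos]; exact Measure.toSphere_ne_zero _,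
      measure_lt_top _ _⟩
  have hre := congrArg Complex.re h
  have him := congrArg Complex.im h
  simp only [Complex.smul_re, Complex.smul_im, Complex.ofReal_re, Complex.ofReal_im,
    smul_eq_mul] at hre him
  refine ⟨?_, ?_⟩
  · rw [← hre] at hJ
    exact nonneg_of_mul_nonneg_right hJ hpos
  · exact (mul_eq_zero.1 him).resolve_left hpos.ne'

end TwoDimensionalPositivity

end ComplexHyperbolicBP

end

/-- The two statements are equivalent. For `n = 2` the sections determine the radial function and
`bpFunction K` is a superposition of measures on complex lines, so both statements hold. For
`n ≥ 3` a body concentrated around a complex axis violates the moment inequality implied by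
positive definiteness, and perturbing it gives a counterexample to the comparison of volumes, so
both statements fail. -/
theorem theorem3 (n : ℕ) (hn : 2 ≤ n) :
    ComplexHyperbolicBP.BusemannPettyAffirmative n ↔
      ∀ K : ConvexBody (ComplexHyperbolicBP.RSpace n), ComplexHyperbolicBP.IsAdmissible K →
        ComplexHyperbolicBP.IsPositiveDefiniteDistribution
          (ComplexHyperbolicBP.bpFunction (K : Set (ComplexHyperbolicBP.RSpace n))) := by
  rcases hn.eq_or_lt with rfl | hn
  · exact iff_of_true ComplexHyperbolicBP.busemannPettyAffirmative_two
      fun K hK => ComplexHyperbolicBP.isPositiveDefiniteDistribution_two hK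
  · refine iff_of_false (ComplexHyperbolicBP.not_busemannPettyAffirmative hn) fun h => ?_
    obtain ⟨K, hK, hnot⟩ := ComplexHyperbolicBP.exists_not_isPositiveDefiniteDistribution hn
    exact hnot (h K hK)
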